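/- **Setting.** Let $n,m\ge 2$ be integers and let $\varepsilon\in(0,1/2]$ with $1/\varepsilon\in\mathbb Z$. There are $n$ agents and $m$ alternatives. A lottery is a point of $\Delta=\{x\in\mathbb R_{\ge0}^m:\sum_j x_j=1\}$, with vertices $e_1,\dots,e_m$. Agent $i$ has an unknown utility vector $u_i\in\{0,\varepsilon,2\varepsilon,\dots,1\}^m$ and an unknown threshold $\tau_i\in\{\varepsilon,2\varepsilon,\dots,1\}$, and accepts $x\in\Delta$ iff $\langle u_i,x\rangle\ge\tau_i$. A lottery is unanimously acceptable if all $n$ agents accept it. An algorithm knows $n,m,\varepsilon$ and obtains information on the agents only through queries $\mathrm{Query}(i,x)$, with $x\in\Delta$, which tell whether agent $i$ accepts $x$; its query complexity is the number of queries. **Subroutines.** $\mathrm{ExactThreshold}(i,k,k')$, for $e_k$ rejected and $e_{k'}$ accepted by agent $i$: start with $\ell=0$, $u=1$; while $u-\ell\ge\varepsilon^2/2$, query agent $i$ at $\alpha e_{k'}+(1-\alpha)e_k$ with $\alpha=(\ell+u)/2$, and set $u:=\alpha$ if it is accepted and $\ell:=\alpha$ otherwise; then, for $q=1,2,\dots,1/\varepsilon$,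 put $p=\lceil q\ell\rceil$ and return the first $p/q\le u$. $\mathrm{LearnHyperplane}(i)$: query agent $i$ at $e_1,\dots,e_m$. If all are accepted return $\textsc{AcceptAll}$; if all are rejected return $\textsc{RejectAll}$. Otherwise take the first rejected $r$ and compute $\alpha_j=\mathrm{ExactThreshold}(i,r,j)$ for all accepted $j$. If all $\alpha_j=1$, return the indicator vector of the accepted indices. Otherwise take the first accepted $a$ with $\alpha_a<1$, compute $\beta_k=\mathrm{ExactThreshold}(i,k,a)$ for all rejected $k\ne r$, and return $c$ with $c_j=1/\alpha_j$ for accepted $j$, $c_r=0$, and $c_k=(1-\beta_k c_a)/(1-\beta_k)$ for rejected $k\neq r$. $\mathrm{Select}(C)$: the lexicographically maximum $x\in\Delta$ with $\langle c,x\rangle\ge1$ for all $c\in C$, or $\textsc{Null}$ if there is none. **Algorithm.** Set $w_i:=1$ for every agent $i$. Repeat the following round. (1) With $W=\sum_i w_i$, draw, independently of the past given the weights, a uniformly random set of $\min\{16(m-1)^2,W\}$ elements, without replacement, from the multiset that contains $w_i$ labelled copies of each agent $i$. (2) Run $\mathrm{LearnHyperplane}(i)$ for each sampled agent $i$ that has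 not been learned before (in increasing order of $i$) and store the result; if it is $\textsc{RejectAll}$, stop and return $\textsc{Null}$. (3) Let $x=\mathrm{Select}(C)$, where $C$ is the set of the vectors stored for the sampled agents (agents of type $\textsc{AcceptAll}$ contribute none); if $x=\textsc{Null}$, stop and return $\textsc{Null}$. (4) Query every agent at $x$. If all accept, stop and return $x$; otherwise double $w_i$ for every agent $i$ that rejects $x$. **Theorem.** There is an absolute constant $C>0$ such that for all $n,m,\varepsilon$ as above and on every instance, the algorithm is always correct, i.e. for every realization of its randomness in which it stops, it returns a unanimously acceptable lottery if one exists and $\textsc{Null}$ otherwise; it stops with probability one; and its expected number of queries is at most $$C\left(nm\log n+\min\{n,\,m^3\log n\}\cdot m\log(1/\varepsilon)\right).$$ -/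

import Mathlib

open scoped ENNReal

noncomputable section

namespace LotteryElicitation

/-! ### Lotteries, agents and the membership oracle -/

/-- Lotteries over `m` alternatives: the probability simplex in `ℝ^m`. -/
abbrev Lottery (m : ℕ) : Type := stdSimplex ℝ (Fin m)

/-- The pure lottery `e_j`. -/
def pureLottery {m : ℕ} (j : Fin m) : Lottery m :=
  ⟨Pi.single j 1, single_mem_stdSimplex ℝ j⟩

/-- The edge lottery `α e_{k'} + (1 - α) e_k`, for `α ∈ [0,1]`. -/
def edgeLottery {m : ℕ} (k k' : Fin m) (α : Set.Icc (0 : ℝ) 1) : Lottery m :=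
  ⟨(α : ℝ) • (pureLottery k' : Fin m → ℝ) + (1 - (α : ℝ)) • (pureLottery k : Fin m → ℝ),
    convex_stdSimplex ℝ (Fin m) (pureLottery k').2 (pureLottery k).2 α.2.1
      (sub_nonneg.2 α.2.2) (by ring)⟩

/-- An instance with `n` agents and `m` alternatives whose utilities lie in `{0, ε, 2ε, …, 1}`
and whose thresholds lie in `{ε, 2ε, …, 1}` (here `1/ε` is a positive integer). -/
structure AgentProfile (n m : ℕ) (ε : ℝ) where
  utility : Fin n → Fin m → ℝ
  threshold : Fin n → ℝ
  utility_grid : ∀ i j, (∃ a : ℕ, utility i j = a * ε) ∧ utility i j ≤ 1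
  threshold_grid : ∀ i, (∃ a : ℕ, 1 ≤ a ∧ threshold i = a * ε) ∧ threshold i ≤ 1

/-- Expected utility of agent `i` under the lottery `x`. -/
def AgentProfile.expectedUtility {n m : ℕ} {ε : ℝ} (I : AgentProfile n m ε) (i : Fin n)
    (x : Lottery m) : ℝ :=
  ∑ j, x.1 j * I.utility i j

/-- Agent `i` accepts the lottery `x`. -/
def AgentProfile.Accepts {n m : ℕ} {ε : ℝ} (I : AgentProfile n m ε) (i : Fin n)
    (x : Lottery m) : Prop :=
  I.threshold i ≤ I.expectedUtility i x

/-- The lottery `x` is acceptable to every agent. -/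
def AgentProfile.UnanimouslyAcceptable {n m : ℕ} {ε : ℝ} (I : AgentProfile n m ε)
    (x : Lottery m) : Prop :=
  ∀ i, I.Accepts i x

/-- An answer is a lottery or `Null`, the latter being represented by `none`. -/
abbrev Answer (m : ℕ) : Type := Option (Lottery m)

/-- An answer is correct if it is a unanimously acceptable lottery, or it is `Null` and there is
no unanimously acceptable lottery. -/
def AgentProfile.CorrectAnswer {n m : ℕ} {ε : ℝ} (I : AgentProfile n m ε) : Answer m → Prop
  | some x => I.UnanimouslyAcceptable x
  | none => ¬ ∃ x : Lottery m, I.UnanimouslyAcceptable x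

/-- A membership oracle answers the queries `Query(i, x)`. -/
abbrev Oracle (n m : ℕ) : Type := Fin n → Lottery m → Bool

open Classical in
/-- The oracle of an instance: `Query(i, x)` is true if and only if agent `i` accepts `x`. -/
def AgentProfile.oracle {n m : ℕ} {ε : ℝ} (I : AgentProfile n m ε) : Oracle n m :=
  fun i x => decide (I.Accepts i x)

/-! ### Query algorithms -/

/-- A deterministic query program (a decision tree) with result type `α`: either it returns, or
it asks `Query(i, x)` and continues according to the Boolean reply. -/
inductive QueryProgram (n m : ℕ) (α : Type) : Type
  | ret (a : α) : QueryProgram n m α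
  | ask (i : Fin n) (x : Lottery m) (next : Bool → QueryProgram n m α) : QueryProgram n m α

namespace QueryProgram

variable {n m : ℕ} {α β ι : Type}

/-- Sequential composition. -/
def bind : QueryProgram n m α → (α → QueryProgram n m β) → QueryProgram n m β
  | ret a, f => f a
  | ask i x next, f => ask i x (fun b => (next b).bind f)

instance : Monad (QueryProgram n m) where
  pure := ret
  bind := bind

/-- The single query `Query(i, x)`. -/
def query (i : Fin n) (x : Lottery m) : QueryProgram n m Bool := ask i x ret

/-- Run `f a` for all `a` in the list `l`, in this order, and record the results in a table;
the table has the value `d` at the entries that are not in `l`. -/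
def tabulate [DecidableEq ι] (d : β) (f : ι → QueryProgram n m β) :
    List ι → QueryProgram n m (ι → β)
  | [] => ret (fun _ => d)
  | a :: l => do
      let b ← f a
      let t ← tabulate d f l
      return Function.update t a b

/-- The value returned when the queries are answered by `O`. -/
def result (O : Oracle n m) : QueryProgram n m α → α
  | ret a => a
  | ask i x next => (next (O i x)).result O

/-- The number of oracle calls made when the queries are answered by `O`. -/
def numQueries (O : Oracle n m) : QueryProgram n m α → ℕ
  | ret _ => 0
  | ask i x next => (next (O i x)).numQueries O + 1

end QueryProgram

/-- A randomized query algorithm, organized in rounds. In a round that starts in the memory state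
`s` it draws a query program at random, from a distribution that depends on `s` only, and runs it;
the result is either the memory state for the next round (`Sum.inl`) or the final answer
(`Sum.inr`). The algorithm learns about the instance through the replies to its queries only. -/
structure RandomizedAlgorithm (n m : ℕ) where
  State : Type
  start : State
  round : State → PMF (QueryProgram n m (State ⊕ Answer m))

namespace RandomizedAlgorithm

variable {n m : ℕ}

/-- The configuration between two rounds: the current memory state, or the final answer if the
algorithm has halted, together with the number of queries made so far. -/
structure Config (A : RandomizedAlgorithm n m) where
  status : A.State ⊕ Answer m
  queries : ℕ

/-- The random effect of a round on the configuration; nothing happens after halting. -/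
def advance (A : RandomizedAlgorithm n m) (O : Oracle n m) (c : A.Config) : PMF A.Config :=
  match c.status with
  | Sum.inl s => (A.round s).map (fun p => ⟨p.result O, c.queries + p.numQueries O⟩)
  | Sum.inr _ => PMF.pure c

/-- The distribution of the configuration after `t` rounds against the oracle `O`. -/
def configLaw (A : RandomizedAlgorithm n m) (O : Oracle n m) : ℕ → PMF A.Config
  | 0 => PMF.pure ⟨Sum.inl A.start, 0⟩
  | t + 1 => (A.configLaw O t).bind (A.advance O)

/-- The expected number of queries made during the first `t` rounds. -/
def expectedQueriesUpTo (A : RandomizedAlgorithm n m) (O : Oracle n m) (t : ℕ) : ℝ≥0∞ :=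
  ∑' c : A.Config, A.configLaw O t c * (c.queries : ℝ≥0∞)

/-- The expected number of queries made during the whole run. The number of queries made so far
does not decrease along a run, so by monotone convergence the expectation of its limit is the
supremum of the expectations over the first `t` rounds. -/
def expectedQueries (A : RandomizedAlgorithm n m) (O : Oracle n m) : ℝ≥0∞ :=
  ⨆ t : ℕ, A.expectedQueriesUpTo O t

/-- The probability that the algorithm has halted after at most `t` rounds. -/
def haltProbability (A : RandomizedAlgorithm n m) (O : Oracle n m) (t : ℕ) : ℝ≥0∞ :=
  (A.configLaw O t).toOuterMeasure {c | ∃ o, c.status = Sum.inr o}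

/-- The algorithm halts with probability one. -/
def HaltsAlmostSurely (A : RandomizedAlgorithm n m) (O : Oracle n m) : Prop :=
  Filter.Tendsto (A.haltProbability O) Filter.atTop (nhds 1)

/-- Some realization of the internal randomness makes the algorithm return `o`. -/
def CanReturn (A : RandomizedAlgorithm n m) (O : Oracle n m) (o : Answer m) : Prop :=
  ∃ t, ∃ c ∈ (A.configLaw O t).support, c.status = Sum.inr o

end RandomizedAlgorithm

/-! ### Learning the halfspace of one agent -/

/-- The midpoint of two numbers in `[0,1]`. -/
def midpoint01 (l u : Set.Icc (0 : ℝ) 1) : Set.Icc (0 : ℝ) 1 :=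
  ⟨((l : ℝ) + u) / 2, by
    have := l.2.1; have := l.2.2; have := u.2.1; have := u.2.2
    constructor <;> linarith⟩

theorem floor_half_lt {x y : ℝ} (hx : 1 ≤ x) (hy : y = x / 2) : ⌊y⌋₊ < ⌊x⌋₊ := by
  have h1 : 1 ≤ ⌊x⌋₊ := Nat.le_floor (by simpa using hx)
  rw [Nat.floor_lt (by subst hy; linarith), hy]
  have h2 := Nat.lt_floor_add_one x
  have h3 : (1 : ℝ) ≤ (⌊x⌋₊ : ℝ) := by exact_mod_cast h1
  linarith

open Classical in
/-- Bisection for the turning point of agent `i` on the edge from `e_k` to `e_{k'}`: while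
`u - l ≥ ε² / 2`, query the midpoint and keep the half that contains the turning point. It returns
the last bracket `(l, u)`. The test `0 < ε` only serves termination; it holds wherever the
algorithm is used. -/
def bisect {n m : ℕ} (ε : ℝ) (i : Fin n) (k k' : Fin m) (l u : Set.Icc (0 : ℝ) 1) :
    QueryProgram n m (Set.Icc (0 : ℝ) 1 × Set.Icc (0 : ℝ) 1) :=
  if _h : 0 < ε ∧ ε ^ 2 / 2 ≤ (u : ℝ) - l then
    QueryProgram.ask i (edgeLottery k k' (midpoint01 l u)) (fun b =>
      if b then bisect ε i k k' l (midpoint01 l u) else bisect ε i k k' (midpoint01 l u) u)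
  else QueryProgram.ret (l, u)
termination_by ⌊((u : ℝ) - l) / (ε ^ 2 / 2)⌋₊
decreasing_by
  all_goals
    have hpos : 0 < ε ^ 2 / 2 := by have := _h.1; positivity
    refine floor_half_lt ((one_le_div hpos).2 _h.2) ?_
    simp only [midpoint01]
    ring

open Classical in
/-- Rational reconstruction: for `q = 1, 2, …, 1/ε` put `p = ⌈q l⌉`, and return the first fraction
`p / q` that is at most `u`. (The last value is used only if there is no such fraction.) -/
def reconstruct (ε l u : ℝ) : ℝ :=
  match (List.range' 1 ⌊1 / ε⌋₊).find? (fun q => decide ((⌈(q : ℝ) * l⌉ : ℝ) / q ≤ u)) with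
  | some q => (⌈(q : ℝ) * l⌉ : ℝ) / q
  | none => u

/-- `ExactThreshold(i, k, k')`: the turning point of agent `i` on the edge from the rejected `e_k`
to the accepted `e_{k'}`. -/
def exactThreshold {n m : ℕ} (ε : ℝ) (i : Fin n) (k k' : Fin m) : QueryProgram n m ℝ := do
  let b ← bisect ε i k k' ⟨0, by simp⟩ ⟨1, by simp⟩
  return reconstruct ε b.1 b.2

/-- The possible outcomes of learning an agent: it accepts all lotteries, it rejects all lotteries,
or it accepts precisely the lotteries `x` with `⟨c, x⟩ ≥ 1`. -/
inductive Learned (m : ℕ) : Type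
  | acceptAll : Learned m
  | rejectAll : Learned m
  | halfspace (c : Fin m → ℝ) : Learned m

open Classical in
/-- `LearnHyperplane(i)`. Free choices of an index are resolved by taking the least one. -/
def learnHyperplane {n m : ℕ} (ε : ℝ) (i : Fin n) : QueryProgram n m (Learned m) := do
  let acc ← QueryProgram.tabulate false
    (fun j : Fin m => QueryProgram.query i (pureLottery j)) (List.finRange m)
  let accepted := (List.finRange m).filter (fun j => acc j)
  let rejected := (List.finRange m).filter (fun j => !acc j)
  match rejected with
  | [] => return Learned.acceptAll
  | r :: rest =>
    if accepted = [] then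
      return Learned.rejectAll
    else
      let α ← QueryProgram.tabulate 1 (fun j => exactThreshold ε i r j) accepted
      match accepted.find? (fun j => decide (α j < 1)) with
      | none => return Learned.halfspace (fun j => if acc j then 1 else 0)
      | some a =>
        let β ← QueryProgram.tabulate 0 (fun k => exactThreshold ε i k a) rest
        return Learned.halfspace (fun j =>
          if acc j then 1 / α j
          else if j = r then 0
          else (1 - β j * (1 / α a)) / (1 - β j))

/-! ### Selecting a candidate lottery -/

/-- The lotteries `x` with `⟨c, x⟩ ≥ 1` for all `c ∈ C`. -/
def feasible {m : ℕ} (C : Set (Fin m → ℝ)) : Set (Lottery m) :=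
  {x | ∀ c ∈ C, 1 ≤ ∑ j, c j * x.1 j}

/-- `x` is the lexicographically maximum element of `F`. -/
def IsLexMax {m : ℕ} (F : Set (Lottery m)) (x : Lottery m) : Prop :=
  x ∈ F ∧ ∀ y ∈ F, toLex (y : Fin m → ℝ) ≤ toLex (x : Fin m → ℝ)

open Classical in
/-- `Select(C)`: the lexicographically maximum feasible lottery, or `Null` if there is none. (The
feasible set is compact, so there is one as soon as the feasible set is nonempty.) -/
def select {m : ℕ} (C : Set (Fin m → ℝ)) : Answer m :=
  if h : ∃ x, IsLexMax (feasible C) x then some h.choose else none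

/-! ### The sampling and reweighting algorithm -/

/-- The multiset that contains `w i` labelled copies of each agent `i`. -/
abbrev Copies {n : ℕ} (w : Fin n → ℕ) : Type := Σ i : Fin n, Fin (w i)

theorem sample_nonempty {n : ℕ} (w : Fin n → ℕ) (r : ℕ) :
    (Finset.powersetCard (min r (∑ i, w i)) (Finset.univ : Finset (Copies w))).Nonempty := by
  rw [Finset.powersetCard_nonempty]
  simp [Finset.card_univ, Fintype.card_sigma]

/-- `WeightedSample(w, min {r, W})`, with `W` the total weight: a uniformly random set of
`min {r, W}` copies, drawn without replacement. -/
def weightedSample {n : ℕ} (w : Fin n → ℕ) (r : ℕ) : PMF (Finset (Copies w)) :=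
  PMF.uniformOfFinset _ (sample_nonempty w r)

/-- The set of distinct agents that appear in a set of copies. -/
def agentsOf {n : ℕ} {w : Fin n → ℕ} (D : Finset (Copies w)) : Finset (Fin n) :=
  D.image Sigma.fst

/-- The memory of the algorithm: the weights, the flags of the learned agents, and the vectors
learned for them (`none` for unlearned agents and for those that accept all lotteries). -/
structure Memory (n m : ℕ) : Type where
  weight : Fin n → ℕ
  known : Fin n → Bool
  vec : Fin n → Option (Fin m → ℝ)

/-- Learn those agents of the list that are not yet known, in order, and store the outcomes; the
result is `none` as soon as an agent turns out to reject all lotteries. -/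
def learnSampled {n m : ℕ} (ε : ℝ) (s : Memory n m) :
    List (Fin n) → QueryProgram n m (Option (Memory n m))
  | [] => return some s
  | i :: l => do
      if s.known i then
        learnSampled ε s l
      else
        match ← learnHyperplane ε i with
        | Learned.rejectAll => return none
        | Learned.acceptAll =>
          learnSampled ε ⟨s.weight, Function.update s.known i true,
            Function.update s.vec i none⟩ l
        | Learned.halfspace c =>
          learnSampled ε ⟨s.weight, Function.update s.known i true,
            Function.update s.vec i (some c)⟩ l

open Classical in
/-- The body of the loop, once the set of sampled agents has been drawn. -/
def loopBody {n m : ℕ} (ε : ℝ) (s : Memory n m) (sampled : Finset (Fin n)) :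
    QueryProgram n m (Memory n m ⊕ Answer m) := do
  match ← learnSampled ε s ((List.finRange n).filter (fun i => decide (i ∈ sampled))) with
  | none => return Sum.inr none
  | some s' =>
    match select {c | ∃ i ∈ sampled, s'.vec i = some c} with
    | none => return Sum.inr none
    | some x =>
      let acc ← QueryProgram.tabulate false (fun i : Fin n => QueryProgram.query i x)
        (List.finRange n)
      if ∀ i, acc i = true then
        return Sum.inr (some x)
      else
        return Sum.inl ⟨fun i => if acc i then s'.weight i else 2 * s'.weight i,
          s'.known, s'.vec⟩

/-- The randomized algorithm, with sample size `16 (m - 1)²`. -/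
def samplingAlgorithm (n m : ℕ) (ε : ℝ) : RandomizedAlgorithm n m where
  State := Memory n m
  start := ⟨fun _ => 1, fun _ => false, fun _ => none⟩
  round s := (weightedSample s.weight (16 * (m - 1) ^ 2)).map
    (fun D => loopBody ε s (agentsOf D))

end LotteryElicitation

end

/-! The algorithm is iterative reweighting for a problem of LP type, in the manner of Clarkson. It
never errs: a lottery is returned only after every agent has accepted it, and `Null` only when the
agents of one sample already have no common acceptable lottery. This uses that learning is exact
(`region_result_learnHyperplane`). A turning point on an edge is a fraction with denominator at most
1/ε, two distinct such fractions differ by at least ε², and so a short bracket determines it; the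
turning points then determine the halfspace.

For the running time, Helly's theorem gives every set of agents a basis of at most m + 1 agents that
fixes the lexicographic maximum (`exists_basis`). Two consequences pull in opposite directions. By
double counting, the expected weight of the agents that reject the candidate of a sample of size r
is at most (m + 1)/(r + 1) times the total weight (`sum_card_violators_mul_le`), so the expected
total weight grows by a factor of at most exp(3/(8m)) per round. On the other hand, every
unsuccessful round doubles the weight of some agent in a fixed basis B of all agents
(`exists_critical_agents`), so after t such rounds the product of the weights over B is at least 2^t
and the total weight is at least exp(23t/(50m)). Comparing the two bounds as in Markov's inequality,
the algorithm is still running after t rounds with probability at most n exp(-t/(12m))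
(`expect_alive_le_exp`), and the expected number of rounds is O(m log n).

A round costs n queries for the acceptance test, plus the cost of learning. The latter is O(m
log(1/ε)) per agent and is charged either to the sample of each round or once to each agent; the
smaller of the two charges gives the minimum in the bound. -/

noncomputable section

namespace LotteryElicitation

/-! ### Values and costs of composed query programs -/

namespace QueryProgram

variable {n m : ℕ} {α β ι : Type}

@[simp]
theorem result_pure (O : Oracle n m) (a : α) :
    (pure a : QueryProgram n m α).result O = a := rfl

@[simp]
theorem numQueries_pure (O : Oracle n m) (a : α) :
    (pure a : QueryProgram n m α).numQueries O = 0 := rfl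

@[simp]
theorem result_bind (O : Oracle n m) (p : QueryProgram n m α) (f : α → QueryProgram n m β) :
    (p >>= f).result O = (f (p.result O)).result O := by
  change (p.bind f).result O = _
  induction p with
  | ret a => rfl
  | ask i x next ih => exact ih _

@[simp]
theorem numQueries_bind (O : Oracle n m) (p : QueryProgram n m α)
    (f : α → QueryProgram n m β) :
    (p >>= f).numQueries O = p.numQueries O + (f (p.result O)).numQueries O := by
  change (p.bind f).numQueries O = _
  induction p with
  | ret a => simp [bind, numQueries, result]
  | ask i x next ih =>
    simp only [bind, numQueries, result, ih]
    ring

@[simp]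
theorem result_query (O : Oracle n m) (i : Fin n) (x : Lottery m) :
    (query i x).result O = O i x := rfl

theorem result_tabulate [DecidableEq ι] (O : Oracle n m) (d : β) (f : ι → QueryProgram n m β)
    (l : List ι) :
    (tabulate d f l).result O = fun a => if a ∈ l then (f a).result O else d := by
  induction l with
  | nil => rfl
  | cons b l ih =>
    ext a
    simp only [tabulate, result_bind, result_pure, ih, Function.update_apply, List.mem_cons]
    by_cases h : a = b <;> simp [h]

theorem numQueries_tabulate_le [DecidableEq ι] (O : Oracle n m) (d : β)
    (f : ι → QueryProgram n m β) (k : ℕ) (l : List ι)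
    (h : ∀ a ∈ l, (f a).numQueries O ≤ k) :
    (tabulate d f l).numQueries O ≤ l.length * k := by
  induction l with
  | nil => simp [tabulate, numQueries]
  | cons b l ih =>
    have h1 := h b (by simp)
    have h2 := ih fun a ha => h a (by simp [ha])
    simp only [tabulate, numQueries_bind, numQueries_pure, List.length_cons, add_mul, one_mul]
    omega

end QueryProgram

/-! ### Acceptance in terms of margins -/

namespace AgentProfile

variable {n m : ℕ} {ε : ℝ} (I : AgentProfile n m ε)

/-- The margin by which agent `i` prefers `e_j` to its threshold. -/
def margin (i : Fin n) (j : Fin m) : ℝ := I.utility i j - I.threshold i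

/-- The lotteries that agent `i` accepts. -/
def region (i : Fin n) : Set (Lottery m) := {x | I.Accepts i x}

theorem accepts_iff (i : Fin n) (x : Lottery m) :
    I.Accepts i x ↔ 0 ≤ ∑ j, x.1 j * I.margin i j := by
  have h : ∑ j, x.1 j * I.margin i j = I.expectedUtility i x - I.threshold i := by
    simp only [margin, mul_sub, Finset.sum_sub_distrib, ← Finset.sum_mul, expectedUtility]
    rw [x.2.2, one_mul]
  rw [h, sub_nonneg, Accepts]

theorem oracle_eq_true (i : Fin n) (x : Lottery m) : I.oracle i x = true ↔ I.Accepts i x := by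
  simp [oracle]

theorem accepts_pureLottery (i : Fin n) (j : Fin m) :
    I.Accepts i (pureLottery j) ↔ 0 ≤ I.margin i j := by
  rw [accepts_iff]
  simp [pureLottery, Pi.single_apply]

theorem accepts_edgeLottery (i : Fin n) (k k' : Fin m) (α : Set.Icc (0 : ℝ) 1) :
    I.Accepts i (edgeLottery k k' α) ↔
      0 ≤ (α : ℝ) * I.margin i k' + (1 - α) * I.margin i k := by
  rw [accepts_iff]
  simp [edgeLottery, pureLottery, Pi.single_apply, add_mul, Finset.sum_add_distrib]

/-- The point of the edge from `e_k` to `e_{k'}` where agent `i` turns to acceptance. -/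
def turningPoint (i : Fin n) (k k' : Fin m) : ℝ :=
  -I.margin i k / (I.margin i k' - I.margin i k)

variable {I} {i : Fin n} {k k' : Fin m}

/-- The margin is affine in α along the edge, with positive slope, so acceptance is monotone in α;
this is what makes bisection valid. -/
theorem accepts_edgeLottery_iff (hk : I.margin i k < 0) (hk' : 0 ≤ I.margin i k')
    (α : Set.Icc (0 : ℝ) 1) :
    I.Accepts i (edgeLottery k k' α) ↔ I.turningPoint i k k' ≤ α := by
  rw [accepts_edgeLottery, turningPoint, div_le_iff₀ (by linarith)]
  constructor <;> intro h <;> nlinarith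

theorem turningPoint_nonneg (hk : I.margin i k < 0) (hk' : 0 ≤ I.margin i k') :
    0 ≤ I.turningPoint i k k' :=
  div_nonneg (by linarith) (by linarith)

theorem turningPoint_le_one (hk : I.margin i k < 0) (hk' : 0 ≤ I.margin i k') :
    I.turningPoint i k k' ≤ 1 :=
  (div_le_one (by linarith)).2 (by linarith)

/-- All margins are integer multiples of ε, which cancels in the quotient. The denominator is the
difference of two utilities in units of ε, hence at most 1/ε. -/
theorem turningPoint_eq_div (hε : 0 < ε) (hk : I.margin i k < 0) (hk' : 0 ≤ I.margin i k') :
    ∃ (a : ℤ) (b : ℕ), 0 < b ∧ (b : ℝ) * ε ≤ 1 ∧ I.turningPoint i k k' = a / b := by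
  obtain ⟨⟨a, ha⟩, -⟩ := I.utility_grid i k
  obtain ⟨⟨a', ha'⟩, h1⟩ := I.utility_grid i k'
  obtain ⟨⟨t, -, ht⟩, -⟩ := I.threshold_grid i
  simp only [margin, ha, ha', ht] at hk hk'
  have hlt : (a : ℝ) < a' := lt_of_mul_lt_mul_right (by linarith : (a : ℝ) * ε < a' * ε) hε.le
  have hlt' : a < a' := by exact_mod_cast hlt
  have hcast : ((a' - a : ℕ) : ℝ) = a' - a := by push_cast [hlt'.le]; ring
  refine ⟨t - a, a' - a, by omega, ?_, ?_⟩
  · rw [hcast]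
    have : 0 ≤ (a : ℝ) * ε := by positivity
    linarith
  · rw [hcast, turningPoint]
    simp only [margin, ha, ha', ht]
    have h2 : (a' : ℝ) - a ≠ 0 := by linarith
    have h3 : (a' * ε - t * ε - (a * ε - t * ε)) ≠ 0 := by
      intro h; exact h2 (mul_right_cancel₀ hε.ne' (by linarith))
    rw [div_eq_div_iff h3 h2]
    push_cast
    ring

end AgentProfile

/-! ### Bisection and rational reconstruction -/

/-- Each query halves a bracket that keeps containing θ, so N halvings suffice when the initial
width is below 2^N times the stopping width. Induction on N avoids the well-founded recursion of
`bisect`. -/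
theorem bisect_spec {n m : ℕ} {ε : ℝ} (hε : 0 < ε) {O : Oracle n m} {i : Fin n} {k k' : Fin m}
    {θ : ℝ} (hθ : ∀ α, O i (edgeLottery k k' α) = true ↔ θ ≤ α) (N : ℕ) :
    ∀ l u : Set.Icc (0 : ℝ) 1, (u : ℝ) - l < 2 ^ N * (ε ^ 2 / 2) → (l : ℝ) ≤ θ → θ ≤ u →
      (bisect ε i k k' l u).numQueries O ≤ N ∧
        (((bisect ε i k k' l u).result O).1 : ℝ) ≤ θ ∧
        θ ≤ ((bisect ε i k k' l u).result O).2 ∧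
        (((bisect ε i k k' l u).result O).2 : ℝ) - ((bisect ε i k k' l u).result O).1
          < ε ^ 2 / 2 := by
  induction N with
  | zero =>
    intro l u h hl hu
    rw [pow_zero, one_mul] at h
    rw [bisect, dif_neg (fun H => absurd H.2 (not_le.2 h))]
    exact ⟨le_rfl, hl, hu, h⟩
  | succ N ih =>
    intro l u h hl hu
    rw [bisect]
    split_ifs with H
    · have hmid : (midpoint01 l u : ℝ) = ((l : ℝ) + u) / 2 := rfl
      simp only [QueryProgram.numQueries, QueryProgram.result, add_le_add_iff_right]
      rw [pow_succ] at h
      by_cases hacc : θ ≤ (midpoint01 l u : ℝ)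
      · rw [(hθ _).2 hacc, if_pos rfl]
        exact ih _ _ (by rw [hmid]; linarith) hl hacc
      · rw [if_neg (fun hO => hacc ((hθ _).1 hO))]
        exact ih _ _ (by rw [hmid]; linarith) (le_of_not_ge hacc) hu
    · exact ⟨Nat.zero_le _, hl, hu, not_le.1 fun h' => H ⟨hε, h'⟩⟩

/-- Over the common denominator qb ≤ 1/ε², the numerator of the difference is an integer of absolute
value less than 1. -/
theorem div_eq_div_of_abs_sub_lt {ε : ℝ} (hε : 0 < ε) {a p : ℤ} {b q : ℕ} (hb : 0 < b)
    (hq : 0 < q) (hbε : (b : ℝ) * ε ≤ 1) (hqε : (q : ℝ) * ε ≤ 1)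
    (h : |(p : ℝ) / q - a / b| < ε ^ 2) : (p : ℝ) / q = a / b := by
  have hb' : (0 : ℝ) < b := by exact_mod_cast hb
  have hq' : (0 : ℝ) < q := by exact_mod_cast hq
  rw [div_sub_div _ _ hq'.ne' hb'.ne', abs_div, abs_of_pos (mul_pos hq' hb'),
    div_lt_iff₀ (mul_pos hq' hb')] at h
  have h1 : ε ^ 2 * (q * b) ≤ 1 := by
    calc ε ^ 2 * (q * b) = (q * ε) * (b * ε) := by ring
      _ ≤ 1 := mul_le_one₀ hqε (by positivity) hbε
  have h2 : |p * b - q * a| < (1 : ℤ) := by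
    have := h.trans_le h1
    exact_mod_cast this
  rw [Int.abs_lt_one_iff, sub_eq_zero] at h2
  rw [div_eq_div_iff hq'.ne' hb'.ne']
  rw [mul_comm (a : ℝ)]
  exact_mod_cast h2

/-- Any fraction that passes the test lies in the bracket, so it is within ε² of θ and must equal θ,
whichever q is met first. The search succeeds because q = b passes: ⌈b l⌉ ≤ b θ = a. -/
theorem reconstruct_eq {ε l u θ : ℝ} (hε : 0 < ε) (hl : l ≤ θ) (hu : θ ≤ u)
    (hlu : u - l < ε ^ 2 / 2) {a : ℤ} {b : ℕ} (hb : 0 < b) (hbε : (b : ℝ) * ε ≤ 1)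
    (hθ : θ = a / b) : reconstruct ε l u = θ := by
  have hb' : (0 : ℝ) < b := by exact_mod_cast hb
  -- The search in `reconstruct` runs over the list of real casts of 1, …, ⌊1/ε⌋₊, so its members
  -- have to be recovered as naturals.
  have hmem : ∀ x : ℝ, x ∈ (do let q ← List.range' 1 ⌊1 / ε⌋₊; pure (q : ℝ) : List ℝ) ↔
      ∃ q : ℕ, (0 < q ∧ (q : ℝ) * ε ≤ 1) ∧ x = q := by
    intro x
    have hiff : ∀ q : ℕ, q ∈ List.range' 1 ⌊1 / ε⌋₊ ↔ 0 < q ∧ (q : ℝ) * ε ≤ 1 := by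
      intro q
      rw [List.mem_range'_1, ← le_div_iff₀ hε, ← Nat.le_floor_iff (by positivity)]
      omega
    simp only [List.bind_eq_flatMap, List.mem_flatMap, hiff, List.pure_def, List.mem_singleton]
  rw [reconstruct]
  split
  · rename_i x hx
    obtain ⟨q, ⟨hq0, hqε⟩, rfl⟩ := (hmem x).1 (List.mem_of_find?_eq_some hx)
    have h2 := List.find?_some hx
    have hq' : (0 : ℝ) < q := by exact_mod_cast hq0
    have h3 : (⌈(q : ℝ) * l⌉ : ℝ) / q ≤ u := by simpa using h2
    have h4 : l ≤ (⌈(q : ℝ) * l⌉ : ℝ) / q := by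
      rw [le_div_iff₀ hq', mul_comm]; exact Int.le_ceil _
    rw [hθ]
    refine div_eq_div_of_abs_sub_lt hε hb hq0 hbε hqε ?_
    rw [← hθ, abs_lt]
    have : 0 < ε ^ 2 := by positivity
    constructor <;> linarith
  · rename_i hnone
    rw [List.find?_eq_none] at hnone
    have h1 := hnone b ((hmem b).2 ⟨b, ⟨hb, hbε⟩, rfl⟩)
    exfalso
    apply h1
    have h2 : ⌈(b : ℝ) * l⌉ ≤ a := by
      rw [Int.ceil_le, mul_comm, ← le_div_iff₀ hb', ← hθ]
      exact hl
    have h3 : (⌈(b : ℝ) * l⌉ : ℝ) ≤ a := by exact_mod_cast h2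
    simpa using (div_le_div_of_nonneg_right h3 hb'.le).trans (hθ ▸ hu)

section

variable {n m : ℕ} {ε : ℝ} {I : AgentProfile n m ε} {i : Fin n} {k k' : Fin m}

theorem result_exactThreshold (hε : 0 < ε) (hk : I.margin i k < 0) (hk' : 0 ≤ I.margin i k') :
    (exactThreshold ε i k k').result I.oracle = I.turningPoint i k k' := by
  obtain ⟨N, hN⟩ := pow_unbounded_of_one_lt (1 / (ε ^ 2 / 2)) (one_lt_two (α := ℝ))
  rw [div_lt_iff₀ (by positivity)] at hN
  obtain ⟨-, h1, h2, h3⟩ := bisect_spec hε (O := I.oracle) (i := i) (k := k) (k' := k')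
    (fun α => (I.oracle_eq_true _ _).trans (AgentProfile.accepts_edgeLottery_iff hk hk' α)) N
    ⟨0, by simp⟩ ⟨1, by simp⟩ (by simpa using hN) (AgentProfile.turningPoint_nonneg hk hk')
    (AgentProfile.turningPoint_le_one hk hk')
  obtain ⟨a, b, hb, hbε, hab⟩ := AgentProfile.turningPoint_eq_div hε hk hk'
  simp only [exactThreshold, QueryProgram.result_bind, QueryProgram.result_pure]
  exact reconstruct_eq hε h1 h2 h3 hb hbε hab

theorem numQueries_exactThreshold_le (hε : 0 < ε) {N : ℕ} (hN : 1 < 2 ^ N * (ε ^ 2 / 2))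
    (hk : I.margin i k < 0) (hk' : 0 ≤ I.margin i k') :
    (exactThreshold ε i k k').numQueries I.oracle ≤ N := by
  simp only [exactThreshold, QueryProgram.numQueries_bind, QueryProgram.numQueries_pure, add_zero]
  exact (bisect_spec hε
    (fun α => (I.oracle_eq_true _ _).trans (AgentProfile.accepts_edgeLottery_iff hk hk' α)) N
    ⟨0, by simp⟩ ⟨1, by simp⟩ (by simpa using hN) (AgentProfile.turningPoint_nonneg hk hk')
    (AgentProfile.turningPoint_le_one hk hk')).1

end

/-! ### Correctness and cost of learning an agent -/

/-- The lotteries that are accepted according to the outcome of learning an agent. -/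
def Learned.region {m : ℕ} : Learned m → Set (Lottery m)
  | acceptAll => Set.univ
  | rejectAll => ∅
  | halfspace c => {x | 1 ≤ ∑ j, c j * x.1 j}

section

variable {n m : ℕ} {ε : ℝ} {I : AgentProfile n m ε} {i : Fin n}

theorem region_eq_univ (h : ∀ j, 0 ≤ I.margin i j) : I.region i = Set.univ := by
  refine Set.eq_univ_of_forall fun x => ?_
  rw [AgentProfile.region, Set.mem_ofPred_eq, I.accepts_iff]
  exact Finset.sum_nonneg fun j _ => mul_nonneg (x.2.1 j) (h j)

theorem region_eq_empty (h : ∀ j, I.margin i j < 0) : I.region i = ∅ := by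
  refine Set.eq_empty_of_forall_notMem fun x hx => ?_
  rw [AgentProfile.region, Set.mem_ofPred_eq, I.accepts_iff] at hx
  have hle : ∀ j ∈ Finset.univ, x.1 j * I.margin i j ≤ 0 := fun j _ =>
    mul_nonpos_of_nonneg_of_nonpos (x.2.1 j) (h j).le
  have h0 := (Finset.sum_eq_zero_iff_of_nonpos hle).1 (le_antisymm (Finset.sum_nonpos hle) hx)
  have hx0 : ∀ j, x.1 j = 0 := fun j =>
    (mul_eq_zero.1 (h0 j (Finset.mem_univ j))).resolve_right (h j).ne
  have := x.2.2
  simp [hx0] at this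

/-- On the simplex the coordinates sum to 1, so adding 1 to every coefficient adds 1 to the linear
form, and rescaling by s > 0 preserves its sign. -/
theorem region_eq_of_margin {c : Fin m → ℝ} {s : ℝ} (hs : 0 < s)
    (hc : ∀ j, c j = 1 + I.margin i j / s) :
    I.region i = (Learned.halfspace c).region := by
  ext x
  have h1 : ∑ j, c j * x.1 j = 1 + (∑ j, x.1 j * I.margin i j) / s := by
    simp only [hc, add_mul, one_mul, Finset.sum_add_distrib, x.2.2, Finset.sum_div]
    congr 1
    exact Finset.sum_congr rfl fun j _ => by ring
  rw [AgentProfile.region, Set.mem_ofPred_eq, I.accepts_iff, Learned.region, Set.mem_ofPred_eq, h1,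
    le_add_iff_nonneg_right, le_div_iff₀ hs, zero_mul]

/-- When no margin is positive, both conditions say that x is supported on the indices in A. -/
theorem region_eq_indicator {A : Fin m → Prop} [DecidablePred A]
    (hA : ∀ j, A j → I.margin i j = 0) (hA' : ∀ j, ¬ A j → I.margin i j < 0) :
    I.region i = (Learned.halfspace (fun j => if A j then 1 else 0)).region := by
  ext x
  rw [AgentProfile.region, Set.mem_ofPred_eq, I.accepts_iff, Learned.region, Set.mem_ofPred_eq]
  have hle : ∀ j ∈ Finset.univ, x.1 j * I.margin i j ≤ 0 := fun j _ => by
    by_cases h : A j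
    · simp [hA j h]
    · exact mul_nonpos_of_nonneg_of_nonpos (x.2.1 j) (hA' j h).le
  have hle' : ∀ j ∈ Finset.univ, (if A j then (1 : ℝ) else 0) * x.1 j ≤ x.1 j := fun j _ => by
    have := x.2.1 j
    split_ifs <;> simp [this]
  have h1 : 0 ≤ ∑ j, x.1 j * I.margin i j ↔ ∀ j, ¬ A j → x.1 j = 0 := by
    rw [(Finset.sum_nonpos hle).ge_iff_eq', eq_comm, Finset.sum_eq_zero_iff_of_nonpos hle]
    refine forall_congr' fun j => ?_
    by_cases h : A j
    · simp [h, hA j h]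
    · simp [h, (hA' j h).ne]
  have h2 : 1 ≤ ∑ j, (if A j then (1 : ℝ) else 0) * x.1 j ↔ ∀ j, ¬ A j → x.1 j = 0 := by
    have h3 := Finset.sum_le_sum hle'
    have h4 := Finset.sum_eq_sum_iff_of_le hle'
    rw [x.2.2] at h3 h4
    rw [h3.ge_iff_eq', eq_comm, h4]
    refine forall_congr' fun j => ?_
    by_cases h : A j
    · simp [h]
    · simp [h, eq_comm]
  rw [h1, h2]

open Classical in
theorem result_tabulate_pureLottery :
    (QueryProgram.tabulate false (fun j : Fin m => QueryProgram.query i (pureLottery j))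
      (List.finRange m)).result I.oracle = fun j => decide (0 ≤ I.margin i j) := by
  rw [QueryProgram.result_tabulate]
  ext j
  rw [if_pos (List.mem_finRange j), QueryProgram.result_query, Bool.eq_iff_iff, I.oracle_eq_true,
    I.accepts_pureLottery, decide_eq_true_iff]

/-- Write μ for the margins. Since α_j = -μ_r/(μ_j - μ_r), the value 1/α_j equals 1 + μ_j/(-μ_r),
and α_j = 1 exactly when μ_j = 0. If some μ_a > 0, the formula for the rejected indices also
simplifies to 1 + μ_k/(-μ_r), so `region_eq_of_margin` applies. If no accepted margin is positive,
`region_eq_indicator` applies. -/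
theorem region_result_learnHyperplane (hε : 0 < ε) :
    ((learnHyperplane ε i).result I.oracle).region = I.region i := by
  classical
  rw [learnHyperplane, QueryProgram.result_bind, result_tabulate_pureLottery]
  dsimp only
  split
  · rename_i hrej
    rw [List.filter_eq_nil_iff] at hrej
    refine (region_eq_univ fun j => ?_).symm
    simpa using hrej j (List.mem_finRange j)
  · rename_i r rest hrej
    have hmem : ∀ k, k ∈ r :: rest ↔ I.margin i k < 0 := fun k => by
      rw [← hrej]; simp
    have hr : I.margin i r < 0 := (hmem r).1 (by simp)
    split_ifs with hnil
    · rw [List.filter_eq_nil_iff] at hnil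
      refine (region_eq_empty fun j => ?_).symm
      simpa using hnil j (List.mem_finRange j)
    -- Only the entries at accepted indices are ever read, so the default value 1 of the table plays
    -- no role.
    · have hα : ∀ j, 0 ≤ I.margin i j → (QueryProgram.tabulate 1
          (fun j => exactThreshold ε i r j)
          ((List.finRange m).filter fun j => decide (0 ≤ I.margin i j))).result I.oracle j
          = I.turningPoint i r j := fun j hj => by
        rw [QueryProgram.result_tabulate]
        simp [hj, result_exactThreshold hε hr hj]
      rw [QueryProgram.result_bind]
      revert hα
      generalize (QueryProgram.tabulate 1 (fun j => exactThreshold ε i r j)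
          ((List.finRange m).filter fun j => decide (0 ≤ I.margin i j))).result I.oracle = α
      intro hα
      split
      · rename_i hnone
        rw [List.find?_eq_none] at hnone
        simp only [QueryProgram.result_pure, decide_eq_true_eq]
        refine (region_eq_indicator (fun j hj => ?_) (fun j hj => not_le.1 hj)).symm
        have h1 := hnone j (by simpa using hj)
        rw [decide_eq_true_eq, hα j hj, AgentProfile.turningPoint, not_lt,
          le_div_iff₀ (by linarith)] at h1
        linarith
      · rename_i a hsome
        have ha : 0 ≤ I.margin i a := by
          simpa using List.mem_of_find?_eq_some hsome
        have ha' : α a < 1 := by simpa using List.find?_some hsome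
        rw [hα a ha, AgentProfile.turningPoint, div_lt_one (by linarith)] at ha'
        have ha0 : 0 < I.margin i a := by linarith
        rw [QueryProgram.result_bind, QueryProgram.result_tabulate]
        simp only [QueryProgram.result_pure, decide_eq_true_eq]
        -- This scale is the one that gives the coefficient of r the value 0.
        refine (region_eq_of_margin (s := -I.margin i r) (by linarith) fun j => ?_).symm
        have hr0 : I.margin i r ≠ 0 := hr.ne
        by_cases hj : 0 ≤ I.margin i j
        · have h2 : I.margin i j - I.margin i r ≠ 0 := by linarith
          rw [if_pos hj, hα j hj, AgentProfile.turningPoint]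
          field_simp
          ring
        · rw [if_neg hj]
          have hj' := not_le.1 hj
          by_cases hjr : j = r
          · subst hjr
            rw [if_pos rfl]
            field_simp
            ring
          · have hjrest : j ∈ rest := by
              have := (hmem j).2 hj'
              simpa [hjr] using this
            have h2 : I.margin i a - I.margin i r ≠ 0 := by linarith
            have h3 : I.margin i a - I.margin i j ≠ 0 := by linarith
            have h4 : 1 - -I.margin i j / (I.margin i a - I.margin i j) =
                I.margin i a / (I.margin i a - I.margin i j) := by
              field_simp
              ring
            rw [if_neg hjr, if_pos hjrest, result_exactThreshold hε hj' ha, hα a ha,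
              AgentProfile.turningPoint, AgentProfile.turningPoint, h4]
            field_simp
            ring

theorem numQueries_learnHyperplane_le (hε : 0 < ε) {N : ℕ} (hN : 1 < 2 ^ N * (ε ^ 2 / 2)) :
    (learnHyperplane ε i).numQueries I.oracle ≤ m * (1 + 2 * N) := by
  classical
  have h1 := QueryProgram.numQueries_tabulate_le I.oracle false
    (fun j : Fin m => QueryProgram.query i (pureLottery j)) 1 (List.finRange m)
    (fun j _ => le_rfl)
  rw [List.length_finRange, mul_one] at h1
  rw [learnHyperplane, QueryProgram.numQueries_bind, result_tabulate_pureLottery, mul_add, mul_one]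
  refine Nat.add_le_add h1 ?_
  dsimp only
  split
  · exact Nat.zero_le _
  · rename_i r rest hrej
    have hmem : ∀ k, k ∈ r :: rest → I.margin i k < 0 := fun k => by
      rw [← hrej]; simp
    have hr : I.margin i r < 0 := hmem r (by simp)
    have hrest : rest.length ≤ m := by
      have h := List.length_filter_le (fun j => !decide (0 ≤ I.margin i j)) (List.finRange m)
      rw [hrej, List.length_finRange, List.length_cons] at h
      omega
    have haccl : ((List.finRange m).filter fun j => decide (0 ≤ I.margin i j)).length ≤ m := by
      simpa using List.length_filter_le (fun j => decide (0 ≤ I.margin i j)) (List.finRange m)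
    split_ifs with hnil
    · exact Nat.zero_le _
    · have h2 := QueryProgram.numQueries_tabulate_le I.oracle 1
        (fun j => exactThreshold ε i r j) N
        ((List.finRange m).filter fun j => decide (0 ≤ I.margin i j))
        (fun j hj => numQueries_exactThreshold_le hε hN hr (by simpa using hj))
      have h2' := h2.trans (Nat.mul_le_mul_right N haccl)
      have htotal : m * (2 * N) = m * N + m * N := by ring
      rw [QueryProgram.numQueries_bind, htotal]
      refine Nat.add_le_add h2' ?_
      split
      · exact Nat.zero_le _
      · rename_i a hsome
        have ha : 0 ≤ I.margin i a := by
          simpa using List.mem_of_find?_eq_some hsome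
        rw [QueryProgram.numQueries_bind, QueryProgram.numQueries_pure, add_zero]
        exact (QueryProgram.numQueries_tabulate_le I.oracle 0
          (fun k => exactThreshold ε i k a) N rest
          (fun k hk => numQueries_exactThreshold_le hε hN (hmem k (by simp [hk])) ha)).trans
          (Nat.mul_le_mul_right N hrest)

end

/-! ### Lexicographic maxima -/

section

variable {m : ℕ}

/-- Coordinates are maximized one after the other: G consists of the points that are optimal in the
first k coordinates, and it stays compact and nonempty. After m steps it is a single point. -/
theorem exists_isLexMax {F : Set (Lottery m)} (hF : IsCompact F) (hne : F.Nonempty) :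
    ∃ x, IsLexMax F x := by
  have key : ∀ k ≤ m, ∃ G ⊆ F, IsCompact G ∧ G.Nonempty ∧
      (∀ x ∈ G, ∀ y ∈ G, ∀ i : Fin m, i.1 < k → x.1 i = y.1 i) ∧
      ∀ x ∈ G, ∀ y ∈ F, y ∉ G → toLex (y : Fin m → ℝ) < toLex (x : Fin m → ℝ) := by
    intro k
    induction k with
    | zero => exact fun _ => ⟨F, subset_rfl, hF, hne, by simp, fun x _ y hy h => absurd hy h⟩
    | succ k ih =>
      intro hk
      obtain ⟨G, hGF, hG, hGne, hagree, hmax⟩ := ih (by omega)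
      have hcont : Continuous fun x : Lottery m => x.1 ⟨k, hk⟩ :=
        (continuous_apply _).comp continuous_subtype_val
      obtain ⟨z, hz, hzmax⟩ := hG.exists_isMaxOn hGne hcont.continuousOn
      refine ⟨G ∩ {x | x.1 ⟨k, hk⟩ = z.1 ⟨k, hk⟩}, fun x hx => hGF hx.1,
        hG.inter_right (isClosed_eq hcont continuous_const), ⟨z, hz, rfl⟩, ?_, ?_⟩
      · intro x hx y hy i hi
        rcases Nat.lt_succ_iff_lt_or_eq.1 hi with h | h
        · exact hagree x hx.1 y hy.1 i h
        · have : i = ⟨k, hk⟩ := Fin.ext h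
          rw [this]
          exact hx.2.trans hy.2.symm
      · intro x hx y hy hyG
        by_cases h : y ∈ G
        · refine ⟨⟨k, hk⟩, fun i hi => hagree y h x hx.1 i hi, ?_⟩
          have h1 : y.1 ⟨k, hk⟩ ≤ z.1 ⟨k, hk⟩ := hzmax h
          have h2 : y.1 ⟨k, hk⟩ ≠ z.1 ⟨k, hk⟩ := fun h' => hyG ⟨h, h'⟩
          exact (lt_of_le_of_ne h1 h2).trans_eq hx.2.symm
        · exact hmax x hx.1 y hy h
  obtain ⟨G, hGF, -, ⟨x, hx⟩, hagree, hmax⟩ := key m le_rfl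
  refine ⟨x, hGF hx, fun y hy => ?_⟩
  by_cases h : y ∈ G
  · exact le_of_eq (congrArg toLex (funext fun i => hagree y h x hx i i.2))
  · exact (hmax x hx y hy h).le

theorem IsLexMax.eq {F : Set (Lottery m)} {x y : Lottery m} (hx : IsLexMax F x)
    (hy : IsLexMax F y) : x = y :=
  Subtype.ext (toLex.injective (le_antisymm (hy.2 x hx.1) (hx.2 y hy.1)))

theorem IsLexMax.mono {F G : Set (Lottery m)} {x : Lottery m} (hx : IsLexMax F x) (hGF : G ⊆ F)
    (hG : x ∈ G) : IsLexMax G x :=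
  ⟨hG, fun y hy => hx.2 y (hGF hy)⟩

open Classical in
/-- The lexicographically maximum element of a set of lotteries, if there is one. -/
def lexMax (F : Set (Lottery m)) : Answer m :=
  if h : ∃ x, IsLexMax F x then some h.choose else none

theorem select_eq_lexMax (C : Set (Fin m → ℝ)) : select C = lexMax (feasible C) := rfl

theorem lexMax_eq_some_iff {F : Set (Lottery m)} {x : Lottery m} :
    lexMax F = some x ↔ IsLexMax F x := by
  rw [lexMax]
  split_ifs with h
  · rw [Option.some_inj]
    exact ⟨fun hx => hx ▸ h.choose_spec, fun hx => h.choose_spec.eq hx⟩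
  · simp only [false_iff]
    exact fun hx => h ⟨x, hx⟩

theorem lexMax_empty : lexMax (∅ : Set (Lottery m)) = none :=
  dif_neg fun ⟨_, hx⟩ => hx.1

theorem eq_empty_of_lexMax_eq_none {F : Set (Lottery m)} (hF : IsCompact F)
    (h : lexMax F = none) : F = ∅ := by
  by_contra hne
  obtain ⟨x, hx⟩ := exists_isLexMax hF (Set.nonempty_iff_ne_empty.2 hne)
  rw [lexMax_eq_some_iff.2 hx] at h
  simp at h

/-- If y and z first exceed x at i and j, their combination first exceeds it at `min i j`. Convexity
lets this set enter Helly's theorem as an extra constraint. -/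
theorem convex_lex_gt (x : Fin m → ℝ) : Convex ℝ {y : Fin m → ℝ | toLex x < toLex y} := by
  rw [convex_iff_forall_pos]
  rintro y ⟨i, hi, hxi⟩ z ⟨j, hj, hxj⟩ a b ha hb hab
  have hx : ∀ k, x k = a * x k + b * x k := fun k => by rw [← add_mul, hab, one_mul]
  refine ⟨min i j, fun k hk => ?_, ?_⟩
  · change x k = a * y k + b * z k
    have h1 : x k = y k := hi k (hk.trans_le (min_le_left _ _))
    have h2 : x k = z k := hj k (hk.trans_le (min_le_right _ _))
    rw [← h1, ← h2]
    exact hx k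
  · change x (min i j) < a * y (min i j) + b * z (min i j)
    have hxi' : x i < y i := hxi
    have hxj' : x j < z j := hxj
    rcases lt_trichotomy i j with h | h | h
    · have h2 : x i = z i := hj i h
      rw [min_eq_left h.le, ← h2]
      nlinarith [hx i, mul_lt_mul_of_pos_left hxi' ha]
    · subst h
      rw [min_self]
      nlinarith [hx i, mul_lt_mul_of_pos_left hxi' ha, mul_lt_mul_of_pos_left hxj' hb]
    · have h2 : x j = y j := hi j h
      rw [min_eq_right h.le, ← h2]
      nlinarith [hx j, mul_lt_mul_of_pos_left hxj' hb]

/-! ### A Helly-type bound on the combinatorial dimension -/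

variable {ι : Type*} {R : ι → Set (Lottery m)}

/-- Let G be the set of points lexicographically above the optimum, or the whole space if A is
infeasible. If every m + 1 constraints of A had a common point in G, Helly's theorem in ℝ^m would
give one for all of A, a contradiction. So some B of at most m + 1 constraints already excludes G,
and so does every A' between B and A. -/
theorem exists_basis (hconv : ∀ i, Convex ℝ (Subtype.val '' R i : Set (Fin m → ℝ)))
    (hclosed : ∀ i, IsClosed (R i)) (A : Finset ι) :
    ∃ B ⊆ A, B.card ≤ m + 1 ∧ ∀ A' : Finset ι, B ⊆ A' → A' ⊆ A →
      lexMax (⋂ i ∈ A', R i) = lexMax (⋂ i ∈ A, R i) := by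
  -- An index in A is needed below to see that the point given by Helly's theorem is a lottery.
  rcases A.eq_empty_or_nonempty with rfl | hA
  · exact ⟨∅, subset_rfl, by simp, fun A' _ h => by rw [Finset.subset_empty.1 h]⟩
  have hcompact : IsCompact (⋂ i ∈ A, R i) :=
    (isClosed_biInter fun i _ => hclosed i).isCompact
  have hmono : ∀ A' : Finset ι, A' ⊆ A → (⋂ i ∈ A, R i) ⊆ ⋂ i ∈ A', R i := fun A' h =>
    Set.biInter_subset_biInter_left h
  have helly : ∀ G : Set (Fin m → ℝ), Convex ℝ G →
      (∀ y ∈ ⋂ i ∈ A, R i, (y : Fin m → ℝ) ∉ G) → ∃ B ⊆ A, B.card ≤ m + 1 ∧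
        ∀ y ∈ ⋂ i ∈ B, R i, (y : Fin m → ℝ) ∉ G := by
    intro G hG hAG
    by_contra! hcon
    have h := Convex.helly_theorem' (𝕜 := ℝ) (s := A)
      (F := fun i => (Subtype.val '' R i : Set (Fin m → ℝ)) ∩ G)
      (fun i _ => (hconv i).inter hG) fun B hB hcard => by
        obtain ⟨y, hy, hyG⟩ := hcon B hB (by simpa using hcard)
        refine ⟨y, Set.mem_iInter₂.2 fun i hi => ⟨⟨y, Set.mem_iInter₂.1 hy i hi, rfl⟩, hyG⟩⟩
    obtain ⟨v, hv⟩ := h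
    rw [Set.mem_iInter₂] at hv
    obtain ⟨i, hi⟩ := hA
    obtain ⟨⟨y, -, rfl⟩, hyG⟩ := hv i hi
    refine hAG y (Set.mem_iInter₂.2 fun j hj => ?_) hyG
    obtain ⟨⟨z, hz, hzy⟩, -⟩ := hv j hj
    rwa [← Subtype.ext hzy]
  cases hlex : lexMax (⋂ i ∈ A, R i) with
  | none =>
    have hempty := eq_empty_of_lexMax_eq_none hcompact hlex
    obtain ⟨B, hBA, hcard, hB⟩ := helly Set.univ convex_univ (by simp [hempty])
    refine ⟨B, hBA, hcard, fun A' hBA' _ => ?_⟩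
    have : (⋂ i ∈ A', R i) = ∅ := Set.eq_empty_of_forall_notMem fun y hy =>
      hB y (Set.biInter_subset_biInter_left hBA' hy) (Set.mem_univ _)
    rw [this, lexMax_empty]
  | some x =>
    have hx := lexMax_eq_some_iff.1 hlex
    obtain ⟨B, hBA, hcard, hB⟩ := helly _ (convex_lex_gt x.1)
      fun y hy => (hx.2 y hy).not_gt
    refine ⟨B, hBA, hcard, fun A' hBA' hA' => ?_⟩
    rw [lexMax_eq_some_iff]
    exact ⟨hmono A' hA' hx.1, fun y hy =>
      not_lt.1 (hB y (Set.biInter_subset_biInter_left hBA' hy))⟩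

end

/-! ### Acceptance regions as constraints, and critical agents -/

section

variable {n m : ℕ} {ε : ℝ} (I : AgentProfile n m ε)

theorem continuous_expected_margin (i : Fin n) :
    Continuous fun x : Lottery m => ∑ j, x.1 j * I.margin i j :=
  continuous_finsetSum _ fun j _ =>
    ((continuous_apply j).comp continuous_subtype_val).mul continuous_const

theorem isClosed_region (i : Fin n) : IsClosed (I.region i) := by
  have h : I.region i = {x | 0 ≤ ∑ j, x.1 j * I.margin i j} := by
    ext x
    exact I.accepts_iff i x
  rw [h]
  exact isClosed_le continuous_const (continuous_expected_margin I i)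

theorem convex_region (i : Fin n) :
    Convex ℝ (Subtype.val '' I.region i : Set (Fin m → ℝ)) := by
  rintro _ ⟨x, hx, rfl⟩ _ ⟨y, hy, rfl⟩ a b ha hb hab
  refine ⟨⟨_, convex_stdSimplex ℝ (Fin m) x.2 y.2 ha hb hab⟩, ?_, rfl⟩
  have hx' := (I.accepts_iff i x).1 hx
  have hy' := (I.accepts_iff i y).1 hy
  refine (I.accepts_iff i _).2 ?_
  have h : ∑ j, (a • x.1 + b • y.1) j * I.margin i j =
      a * ∑ j, x.1 j * I.margin i j + b * ∑ j, y.1 j * I.margin i j := by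
    simp only [Finset.mul_sum, ← Finset.sum_add_distrib, Pi.add_apply, Pi.smul_apply, smul_eq_mul]
    exact Finset.sum_congr rfl fun j _ => by ring
  exact h ▸ add_nonneg (mul_nonneg ha hx') (mul_nonneg hb hy')

/-- The candidate lottery that is selected if the agents in `A` are sampled. -/
def AgentProfile.candidate (A : Finset (Fin n)) : Answer m := lexMax (⋂ i ∈ A, I.region i)

variable {I} {A : Finset (Fin n)} {x : Lottery m}

theorem accepts_of_candidate_eq_some (h : I.candidate A = some x) {i : Fin n} (hi : i ∈ A) :
    I.Accepts i x :=
  Set.mem_iInter₂.1 (lexMax_eq_some_iff.1 h).1 i hi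

theorem candidate_eq_none_of_region_eq_empty {i : Fin n} (hi : i ∈ A)
    (h : I.region i = ∅) : I.candidate A = none := by
  have : (⋂ i ∈ A, I.region i) = ∅ := Set.eq_empty_of_forall_notMem fun y hy => by
    simpa [h] using Set.mem_iInter₂.1 hy i hi
  rw [AgentProfile.candidate, this, lexMax_empty]

theorem not_unanimouslyAcceptable_of_candidate_eq_none (h : I.candidate A = none)
    (y : Lottery m) : ¬ I.UnanimouslyAcceptable y := fun hy => by
  have := eq_empty_of_lexMax_eq_none
    (isClosed_biInter fun i _ => isClosed_region I i).isCompact h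
  exact Set.notMem_empty y (this ▸ Set.mem_iInter₂.2 fun i _ => hy i)

variable (I) in
theorem exists_candidate_basis (A : Finset (Fin n)) :
    ∃ B ⊆ A, B.card ≤ m + 1 ∧ ∀ A' : Finset (Fin n), B ⊆ A' → A' ⊆ A →
      I.candidate A' = I.candidate A :=
  exists_basis (convex_region I) (isClosed_region I) A

variable (I) in
/-- There are few agents such that each candidate that they accept is accepted by all. -/
theorem exists_critical_agents :
    ∃ B : Finset (Fin n), B.card ≤ m + 1 ∧ ∀ A x, I.candidate A = some x →
      (∀ i ∈ B, I.Accepts i x) → I.UnanimouslyAcceptable x := by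
  classical
  obtain ⟨B, -, hcard, hB⟩ := exists_candidate_basis I Finset.univ
  refine ⟨B, hcard, fun A x hx hacc i => ?_⟩
  -- Adding B to A removes feasible points but not x, so x stays optimal for A ∪ B; as B is a basis
  -- of all agents, x is then the optimum for all of them.
  have h1 := hB (A ∪ B) Finset.subset_union_right (Finset.subset_univ _)
  have h2 : I.candidate (A ∪ B) = some x := by
    refine lexMax_eq_some_iff.2 ((lexMax_eq_some_iff.1 hx).mono
      (Set.biInter_subset_biInter_left (Finset.subset_union_left (s₁ := A))) ?_)
    refine Set.mem_iInter₂.2 fun j hj => ?_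
    rcases Finset.mem_union.1 hj with h | h
    · exact accepts_of_candidate_eq_some hx h
    · exact hacc j h
  exact accepts_of_candidate_eq_some (h1 ▸ h2) (Finset.mem_univ i)

end

/-! ### The sampling lemma -/

/-- Double counting: a violator h of D is recorded as the set `insert h D` of size r + 1 with h
marked. In a set S, only elements of its basis can be violated after their removal, so at most d
marks are possible. -/
theorem sum_card_violators_le {α : Type*} [Fintype α] [DecidableEq α] (V : Finset α → Finset α)
    (d r : ℕ) (hV : ∀ D, ∀ h ∈ V D, h ∉ D)
    (hd : ∀ S : Finset α, ∃ B ⊆ S, B.card ≤ d ∧ ∀ h ∈ S, h ∉ B → h ∉ V (S.erase h)) :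
    ∑ D ∈ Finset.powersetCard r Finset.univ, (V D).card ≤
      (Fintype.card α).choose (r + 1) * d := by
  calc ∑ D ∈ Finset.powersetCard r Finset.univ, (V D).card
      = ((Finset.powersetCard r Finset.univ).sigma V).card := (Finset.card_sigma _ _).symm
    _ ≤ ((Finset.powersetCard (r + 1) (Finset.univ : Finset α)).sigma
          fun S => S.filter fun h => h ∈ V (S.erase h)).card := by
        refine Finset.card_le_card_of_injOn
          (fun p => (⟨insert p.2 p.1, p.2⟩ : Σ _ : Finset α, α)) ?_ ?_
        · rintro ⟨D, h⟩ hp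
          simp only [Finset.coe_sigma, Set.mem_sigma_iff, Finset.mem_coe,
            Finset.mem_powersetCard_univ, Finset.mem_filter] at hp ⊢
          have hD := hV D h hp.2
          rw [Finset.card_insert_of_notMem hD, hp.1, Finset.erase_insert hD]
          exact ⟨rfl, Finset.mem_insert_self _ _, hp.2⟩
        · rintro ⟨D, h⟩ hp ⟨D', h'⟩ hp' heq
          simp only [Finset.coe_sigma, Set.mem_sigma_iff, Finset.mem_coe] at hp hp'
          simp only [Sigma.mk.injEq, heq_eq_eq] at heq
          obtain ⟨h1, rfl⟩ := heq
          have h2 := congrArg (fun S => S.erase h) h1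
          simp only [Finset.erase_insert (hV D h hp.2), Finset.erase_insert (hV D' h hp'.2)] at h2
          rw [h2]
    _ = ∑ S ∈ Finset.powersetCard (r + 1) Finset.univ,
          (S.filter fun h => h ∈ V (S.erase h)).card := Finset.card_sigma _ _
    _ ≤ (Finset.powersetCard (r + 1) (Finset.univ : Finset α)).card * d := by
        refine Finset.sum_le_card_nsmul _ _ _ fun S _ => ?_
        obtain ⟨B, -, hcard, hB⟩ := hd S
        refine (Finset.card_le_card fun h hh => ?_).trans hcard
        rw [Finset.mem_filter] at hh
        by_contra hn
        exact hB h hh.1 hn hh.2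
    _ = _ := by rw [Finset.card_powersetCard, Finset.card_univ]

section

variable {n m : ℕ} {ε : ℝ} (I : AgentProfile n m ε) (w : Fin n → ℕ)

open Classical in
/-- The copies of agents that reject the candidate lottery of a sample. -/
def violators (D : Finset (Copies w)) : Finset (Copies w) :=
  Finset.univ.filter fun h => ∃ x, I.candidate (agentsOf D) = some x ∧ ¬ I.Accepts h.1 x

theorem sum_card_violators_mul_le (r : ℕ) :
    (∑ D ∈ Finset.powersetCard (min r (∑ i, w i)) Finset.univ, (violators I w D).card) * (r + 1) ≤
      (m + 1) * (∑ i, w i) * (∑ i, w i).choose (min r (∑ i, w i)) := by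
  classical
  have hcard : Fintype.card (Copies w) = ∑ i, w i := by simp [Fintype.card_sigma]
  have h := sum_card_violators_le (violators I w) (m + 1) (min r (∑ i, w i))
    (fun D h hh hD => by
      obtain ⟨x, hx, hrej⟩ := (Finset.mem_filter.1 hh).2
      exact hrej (accepts_of_candidate_eq_some hx (Finset.mem_image_of_mem _ hD)))
    (fun S => by
      obtain ⟨B, hBS, hBcard, hB⟩ := exists_candidate_basis I (agentsOf S)
      have hcopy : ∀ i ∈ B, ∃ h ∈ S, h.1 = i := fun i hi => by
        simpa only [Finset.mem_image] using Finset.mem_image.1 (hBS hi)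
      choose c hcS hci using hcopy
      -- One copy of each basis agent is enough: removing any other copy from S leaves all basis
      -- agents present, hence the candidate unchanged.
      refine ⟨B.attach.image fun i => c i.1 i.2, fun h hh => ?_,
        (Finset.card_image_le.trans_eq Finset.card_attach).trans hBcard, ?_⟩
      · obtain ⟨i, -, rfl⟩ := Finset.mem_image.1 hh
        exact hcS i.1 i.2
      · intro h hS hnot hviol
        obtain ⟨x, hx, hrej⟩ := (Finset.mem_filter.1 hviol).2
        rw [hB (agentsOf (S.erase h))
          (fun i hi => Finset.mem_image.2 ⟨c i hi, Finset.mem_erase.2 ⟨fun he =>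
            hnot (Finset.mem_image.2 ⟨⟨i, hi⟩, Finset.mem_attach _ _, he⟩), hcS i hi⟩, hci i hi⟩)
          (Finset.image_subset_image (Finset.erase_subset _ _))] at hx
        exact hrej (accepts_of_candidate_eq_some hx (Finset.mem_image_of_mem _ hS)))
  rw [hcard] at h
  -- If r ≥ W, every copy is sampled and nothing is violated: the bound contains W choose (W + 1) =
  -- 0. Otherwise (r + 1) · (W choose r + 1) = (W - r) · (W choose r).
  rcases le_total (∑ i, w i) r with hr | hr
  · rw [min_eq_right hr, Nat.choose_succ_self, zero_mul, Nat.le_zero] at h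
    rw [min_eq_right hr, h, zero_mul]
    exact Nat.zero_le _
  · rw [min_eq_left hr] at h ⊢
    calc _ ≤ (∑ i, w i).choose (r + 1) * (m + 1) * (r + 1) := Nat.mul_le_mul_right _ h
      _ = (m + 1) * ((∑ i, w i).choose (r + 1) * (r + 1)) := by ring
      _ = (m + 1) * ((∑ i, w i).choose r * ((∑ i, w i) - r)) := by
        rw [Nat.choose_succ_right_eq]
      _ ≤ (m + 1) * ((∑ i, w i).choose r * (∑ i, w i)) := by gcongr; exact Nat.sub_le _ _
      _ = _ := by ring

open Classical in
theorem card_violators {D : Finset (Copies w)} {x : Lottery m}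
    (hx : I.candidate (agentsOf D) = some x) :
    (violators I w D).card = ∑ i, if I.Accepts i x then 0 else w i := by
  simp only [violators, hx, Option.some_inj, exists_eq_left']
  rw [Finset.card_filter, Fintype.sum_sigma]
  refine Finset.sum_congr rfl fun i _ => ?_
  by_cases h : I.Accepts i x <;> simp [h]

end

/-! ### One round of the algorithm -/

/-- The lotteries that are accepted according to a stored vector. -/
def vecRegion {m : ℕ} : Option (Fin m → ℝ) → Set (Lottery m)
  | none => Set.univ
  | some c => (Learned.halfspace c).region

section

variable {n m : ℕ} {ε : ℝ}

/-- The vectors stored for the known agents are correct. -/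
def Memory.Consistent (s : Memory n m) (I : AgentProfile n m ε) : Prop :=
  ∀ i, s.known i = true → vecRegion (s.vec i) = I.region i

/-- The number of agents that have not been learned. -/
def Memory.numUnknown (s : Memory n m) : ℕ := (Finset.univ.filter fun i => s.known i = false).card

/-- A bound on the cost of learning the remaining agents at a cost of at most `L` each. -/
def remainingCost (L : ℕ) : Memory n m ⊕ Answer m → ℕ
  | Sum.inl s => L * s.numUnknown
  | Sum.inr _ => 0

theorem Memory.Consistent.update {s : Memory n m} {I : AgentProfile n m ε} (hs : s.Consistent I)
    {i : Fin n} {v : Option (Fin m → ℝ)} (hv : vecRegion v = I.region i) :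
    (⟨s.weight, Function.update s.known i true, Function.update s.vec i v⟩ :
      Memory n m).Consistent I := by
  intro j hj
  by_cases h : j = i
  · subst h
    simpa using hv
  · simp only [Function.update_of_ne h] at hj ⊢
    exact hs j hj

theorem Memory.numUnknown_update {s : Memory n m} {i : Fin n} (hi : s.known i = false)
    (w : Fin n → ℕ) (v : Fin n → Option (Fin m → ℝ)) :
    (⟨w, Function.update s.known i true, v⟩ : Memory n m).numUnknown + 1 = s.numUnknown := by
  have h : (Finset.univ.filter fun j => Function.update s.known i true j = false) =
      (Finset.univ.filter fun j => s.known j = false).erase i := by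
    ext j
    by_cases h : j = i
    · subst h; simp
    · simp [h]
  rw [Memory.numUnknown, Memory.numUnknown, h, Finset.card_erase_of_mem (by simp [hi])]
  have : 0 < (Finset.univ.filter fun j => s.known j = false).card :=
    Finset.card_pos.2 ⟨i, by simp [hi]⟩
  omega

theorem result_learnSampled {I : AgentProfile n m ε} (hε : 0 < ε) (l : List (Fin n)) :
    ∀ s : Memory n m, s.Consistent I →
      ((learnSampled ε s l).result I.oracle = none ∧ ∃ i ∈ l, I.region i = ∅) ∨
      ∃ s', (learnSampled ε s l).result I.oracle = some s' ∧ s'.Consistent I ∧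
        s'.weight = s.weight ∧ ∀ i, s.known i = true ∨ i ∈ l → s'.known i = true := by
  induction l with
  | nil => exact fun s hs => Or.inr ⟨s, rfl, hs, rfl, by simp⟩
  | cons i l ih =>
    intro s hs
    rw [learnSampled]
    split_ifs with hi
    · rcases ih s hs with ⟨h, j, hj, hj'⟩ | ⟨s', h, h1, h2, h3⟩
      · exact Or.inl ⟨h, j, by simp [hj], hj'⟩
      · refine Or.inr ⟨s', h, h1, h2, fun j hj => h3 j ?_⟩
        rcases hj with hj | hj
        · exact Or.inl hj
        · rcases List.mem_cons.1 hj with rfl | hj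
          · exact Or.inl hi
          · exact Or.inr hj
    · have hreg := region_result_learnHyperplane (I := I) (i := i) hε
      have hstep : ∀ v, vecRegion v = I.region i →
          ((learnSampled ε ⟨s.weight, Function.update s.known i true,
            Function.update s.vec i v⟩ l).result I.oracle = none ∧
              ∃ j ∈ i :: l, I.region j = ∅) ∨
          ∃ s', (learnSampled ε ⟨s.weight, Function.update s.known i true,
            Function.update s.vec i v⟩ l).result I.oracle = some s' ∧ s'.Consistent I ∧
            s'.weight = s.weight ∧ ∀ j, s.known j = true ∨ j ∈ i :: l → s'.known j = true := by
        intro v hv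
        rcases ih _ (hs.update hv) with ⟨h, j, hj, hj'⟩ | ⟨s', h, h1, h2, h3⟩
        · exact Or.inl ⟨h, j, by simp [hj], hj'⟩
        · refine Or.inr ⟨s', h, h1, h2, fun j hj => h3 j ?_⟩
          by_cases hji : j = i
          · subst hji; simp
          · simpa [hji] using hj
      rw [QueryProgram.result_bind]
      revert hreg
      cases (learnHyperplane ε i).result I.oracle with
      | acceptAll => exact fun hreg => hstep none hreg
      | rejectAll => exact fun hreg => Or.inl ⟨rfl, i, by simp, hreg.symm⟩
      | halfspace c => exact fun hreg => hstep (some c) hreg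

/-- Two ways to pay for learning: L per listed agent, or amortized, with L times the number of
unlearned agents as a potential. -/
theorem numQueries_learnSampled_le {O : Oracle n m} {L : ℕ}
    (hL : ∀ i, (learnHyperplane ε i).numQueries O ≤ L) (l : List (Fin n)) :
    ∀ s : Memory n m, (learnSampled ε s l).numQueries O ≤ L * l.length ∧
      (learnSampled ε s l).numQueries O +
        ((learnSampled ε s l).result O).elim 0 (fun s' => L * s'.numUnknown)
          ≤ L * s.numUnknown := by
  induction l with
  | nil => exact fun s => ⟨Nat.zero_le _, (Nat.zero_add _).le⟩
  | cons i l ih =>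
    intro s
    rw [learnSampled]
    split_ifs with hi
    · obtain ⟨h1, h2⟩ := ih s
      exact ⟨h1.trans (Nat.mul_le_mul_left _ (by simp)), h2⟩
    · rw [QueryProgram.numQueries_bind, QueryProgram.result_bind, List.length_cons, mul_add,
        mul_one]
      have hi' : s.known i = false := by simpa using hi
      have hLi := hL i
      have hcount : ∀ v : Option (Fin m → ℝ), L * (⟨s.weight, Function.update s.known i true,
          Function.update s.vec i v⟩ : Memory n m).numUnknown + L = L * s.numUnknown := fun v => by
        rw [← Memory.numUnknown_update hi' s.weight (Function.update s.vec i v), mul_add, mul_one]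
      cases (learnHyperplane ε i).result O with
      | acceptAll =>
        obtain ⟨h1, h2⟩ := ih ⟨s.weight, Function.update s.known i true,
          Function.update s.vec i none⟩
        have h3 := hcount none
        dsimp only
        exact ⟨by omega, by omega⟩
      | rejectAll =>
        have h3 := hcount none
        simp only [QueryProgram.numQueries_pure, QueryProgram.result_pure, Option.elim_none]
        exact ⟨by omega, by omega⟩
      | halfspace c =>
        obtain ⟨h1, h2⟩ := ih ⟨s.weight, Function.update s.known i true,
          Function.update s.vec i (some c)⟩
        have h3 := hcount (some c)
        dsimp only
        exact ⟨by omega, by omega⟩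

theorem feasible_eq_biInter {I : AgentProfile n m ε} {s : Memory n m} (hs : s.Consistent I)
    {A : Finset (Fin n)} (hA : ∀ i ∈ A, s.known i = true) :
    feasible {c | ∃ i ∈ A, s.vec i = some c} = ⋂ i ∈ A, I.region i := by
  ext x
  rw [Set.mem_iInter₂]
  constructor
  · intro hx i hi
    rw [← hs i (hA i hi)]
    cases hc : s.vec i with
    | none => exact Set.mem_univ x
    | some c => exact hx c ⟨i, hi, hc⟩
  · rintro hx c ⟨i, hi, hc⟩
    have h := hx i hi
    rw [← hs i (hA i hi), hc] at h
    exact h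

theorem numQueries_acceptance_le (O : Oracle n m) (x : Lottery m) :
    (QueryProgram.tabulate false (fun i : Fin n => QueryProgram.query i x)
      (List.finRange n)).numQueries O ≤ n := by
  simpa using QueryProgram.numQueries_tabulate_le O false
    (fun i : Fin n => QueryProgram.query i x) 1 (List.finRange n) fun _ _ => le_rfl

theorem result_acceptance (O : Oracle n m) (x : Lottery m) :
    (QueryProgram.tabulate false (fun i : Fin n => QueryProgram.query i x)
      (List.finRange n)).result O = fun i => O i x := by
  rw [QueryProgram.result_tabulate]
  simp

-- Exact learning makes the outcome of a round depend on the sample only through `candidate`; the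
-- analysis of the weights uses nothing else about the program.
open Classical in
theorem result_loopBody {I : AgentProfile n m ε} (hε : 0 < ε) {s : Memory n m}
    (hs : s.Consistent I) (A : Finset (Fin n)) :
    (I.candidate A = none ∧ (loopBody ε s A).result I.oracle = Sum.inr none) ∨
    ∃ x, I.candidate A = some x ∧
      ((I.UnanimouslyAcceptable x ∧ (loopBody ε s A).result I.oracle = Sum.inr (some x)) ∨
      (¬ I.UnanimouslyAcceptable x ∧ ∃ s', (loopBody ε s A).result I.oracle = Sum.inl s' ∧
        s'.Consistent I ∧
        s'.weight = fun i => if I.Accepts i x then s.weight i else 2 * s.weight i)) := by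
  have hmem : ∀ i, i ∈ (List.finRange n).filter (fun i => decide (i ∈ A)) ↔ i ∈ A := by simp
  rw [loopBody, QueryProgram.result_bind]
  rcases result_learnSampled (I := I) hε
    ((List.finRange n).filter (fun i => decide (i ∈ A))) s hs with
    ⟨h, i, hi, hi'⟩ | ⟨s', h, h1, h2, h3⟩
  · rw [h]
    exact Or.inl ⟨candidate_eq_none_of_region_eq_empty ((hmem i).1 hi) hi', rfl⟩
  · rw [h]
    dsimp only
    rw [select_eq_lexMax, feasible_eq_biInter h1 (fun i hi => h3 i (Or.inr ((hmem i).2 hi)))]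
    change (I.candidate A = none ∧ QueryProgram.result I.oracle
      (match I.candidate A with | none => _ | some x => _) = _) ∨ _
    cases hc : I.candidate A with
    | none => exact Or.inl ⟨rfl, rfl⟩
    | some x =>
      refine Or.inr ⟨x, rfl, ?_⟩
      have hc' : lexMax (⋂ i ∈ A, I.region i) = some x := hc
      rw [hc']
      dsimp only
      rw [QueryProgram.result_bind, result_acceptance]
      have hiff : (∀ i, I.oracle i x = true) ↔ I.UnanimouslyAcceptable x :=
        forall_congr' fun i => I.oracle_eq_true i x
      by_cases hx : I.UnanimouslyAcceptable x
      · rw [if_pos (hiff.2 hx)]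
        exact Or.inl ⟨hx, rfl⟩
      · rw [if_neg (mt hiff.1 hx)]
        refine Or.inr ⟨hx, _, rfl, h1, funext fun i => ?_⟩
        simp only [I.oracle_eq_true, h2]

theorem numQueries_loopBody_le {O : Oracle n m} {L : ℕ}
    (hL : ∀ i, (learnHyperplane ε i).numQueries O ≤ L) (s : Memory n m) (A : Finset (Fin n)) :
    (loopBody ε s A).numQueries O ≤ n + L * A.card ∧
      (loopBody ε s A).numQueries O + remainingCost L ((loopBody ε s A).result O) ≤
        n + L * s.numUnknown := by
  classical
  have hlen : ((List.finRange n).filter (fun i => decide (i ∈ A))).length = A.card := by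
    rw [← List.toFinset_card_of_nodup ((List.nodup_finRange n).filter _)]
    congr 1
    ext i
    simp
  obtain ⟨h1, h2⟩ := numQueries_learnSampled_le hL
    ((List.finRange n).filter (fun i => decide (i ∈ A))) s
  rw [hlen] at h1
  rw [loopBody, QueryProgram.numQueries_bind, QueryProgram.result_bind]
  revert h2
  cases (learnSampled ε s ((List.finRange n).filter (fun i => decide (i ∈ A)))).result O with
  | none =>
    intro h2
    simp only [QueryProgram.numQueries_pure, QueryProgram.result_pure, remainingCost,
      Option.elim_none] at h2 ⊢
    exact ⟨by omega, by omega⟩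
  | some s' =>
    intro h2
    rw [Option.elim_some] at h2
    dsimp only
    cases select {c | ∃ i ∈ A, s'.vec i = some c} with
    | none =>
      simp only [QueryProgram.numQueries_pure, QueryProgram.result_pure, remainingCost]
      exact ⟨by omega, by omega⟩
    | some x =>
      dsimp only
      have h3 := numQueries_acceptance_le O x
      rw [QueryProgram.numQueries_bind, QueryProgram.result_bind, result_acceptance]
      split_ifs
      · simp only [QueryProgram.numQueries_pure, QueryProgram.result_pure, remainingCost]
        exact ⟨by omega, by omega⟩
      · simp only [QueryProgram.numQueries_pure, QueryProgram.result_pure, remainingCost,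
          Memory.numUnknown] at h2 ⊢
        exact ⟨by omega, by omega⟩

end

/-! ### Expectations with respect to a probability mass function -/

section

variable {α β : Type*}

/-- The expectation of a nonnegative function. -/
def expect (p : PMF α) (f : α → ℝ≥0∞) : ℝ≥0∞ := ∑' a, p a * f a

theorem expect_pure (a : α) (f : α → ℝ≥0∞) : expect (PMF.pure a) f = f a := by
  rw [expect, tsum_eq_single a fun b hb => by simp [PMF.pure_apply, hb], PMF.pure_apply_self,
    one_mul]

theorem expect_bind (p : PMF α) (k : α → PMF β) (f : β → ℝ≥0∞) :
    expect (p.bind k) f = expect p fun a => expect (k a) f := by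
  simp only [expect, PMF.bind_apply, ← ENNReal.tsum_mul_right, ← ENNReal.tsum_mul_left]
  rw [ENNReal.tsum_comm]
  simp only [mul_assoc]

theorem expect_map (p : PMF α) (g : α → β) (f : β → ℝ≥0∞) :
    expect (p.map g) f = expect p fun a => f (g a) := by
  rw [← PMF.bind_pure_comp, expect_bind]
  simp only [Function.comp_apply, expect_pure]

theorem expect_mono {p : PMF α} {f g : α → ℝ≥0∞} (h : ∀ a ∈ p.support, f a ≤ g a) :
    expect p f ≤ expect p g := by
  refine ENNReal.tsum_le_tsum fun a => ?_
  by_cases ha : a ∈ p.support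
  · exact mul_le_mul_right (h a ha) _
  · rw [(p.apply_eq_zero_iff a).2 ha, zero_mul, zero_mul]

theorem expect_add (p : PMF α) (f g : α → ℝ≥0∞) :
    expect p (fun a => f a + g a) = expect p f + expect p g := by
  simp only [expect, mul_add, ENNReal.tsum_add]

theorem expect_const_mul (p : PMF α) (K : ℝ≥0∞) (f : α → ℝ≥0∞) :
    expect p (fun a => K * f a) = K * expect p f := by
  simp only [expect, ← ENNReal.tsum_mul_left, mul_left_comm]

theorem expect_const (p : PMF α) (K : ℝ≥0∞) : expect p (fun _ => K) = K := by
  rw [expect, ENNReal.tsum_mul_right, p.tsum_coe, one_mul]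

theorem expect_uniformOfFinset (s : Finset α) (hs : s.Nonempty) (f : α → ℝ≥0∞) :
    expect (PMF.uniformOfFinset s hs) f = (∑ a ∈ s, f a) / s.card := by
  rw [expect, tsum_eq_sum (s := s) fun a ha => by
    rw [PMF.uniformOfFinset_apply_of_notMem hs ha, zero_mul], div_eq_mul_inv, Finset.sum_mul]
  exact Finset.sum_congr rfl fun a ha => by
    rw [PMF.uniformOfFinset_apply_of_mem hs ha, mul_comm]

end

section

variable {n m : ℕ} {ε : ℝ}

theorem expect_card_violators_le (I : AgentProfile n m ε) (w : Fin n → ℕ) (r : ℕ) :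
    expect (weightedSample w r) (fun D => ((violators I w D).card : ℝ≥0∞)) ≤
      ((m + 1 : ℕ) : ℝ≥0∞) / (r + 1 : ℕ) * (∑ i, w i : ℕ) := by
  have h := sum_card_violators_mul_le I w r
  have hcard : (Finset.powersetCard (min r (∑ i, w i)) (Finset.univ : Finset (Copies w))).card =
      (∑ i, w i).choose (min r (∑ i, w i)) := by
    simp [Finset.card_powersetCard, Finset.card_univ, Fintype.card_sigma]
  have hpos : 0 < (∑ i, w i).choose (min r (∑ i, w i)) := Nat.choose_pos (min_le_right _ _)
  rw [weightedSample, expect_uniformOfFinset, hcard, ← Nat.cast_sum]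
  refine ENNReal.div_le_of_le_mul ?_
  rw [ENNReal.div_eq_inv_mul, mul_assoc, mul_assoc,
    ← ENNReal.mul_le_iff_le_inv (by positivity) (by simp)]
  rw [mul_comm, ← mul_assoc]
  exact_mod_cast h

/-! ### The run of the algorithm -/

/-- The configurations of the sampling algorithm. -/
abbrev SamplingConfig (n m : ℕ) (ε : ℝ) : Type := (samplingAlgorithm n m ε).Config

/-- A configuration of the sampling algorithm, given by its components. -/
def config (ε : ℝ) (x : Memory n m ⊕ Answer m) (q : ℕ) : SamplingConfig n m ε := ⟨x, q⟩

theorem exists_eq_config (c : SamplingConfig n m ε) : ∃ x q, c = config ε x q :=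
  ⟨c.status, c.queries, rfl⟩

/-- The indicator of the configurations in which the algorithm has not halted. -/
def alive (c : SamplingConfig n m ε) : ℝ≥0∞ :=
  c.status.elim (fun _ => 1) fun _ => 0

/-- The total weight, which is counted as zero after halting. -/
def totalWeight (c : SamplingConfig n m ε) : ℝ≥0∞ :=
  c.status.elim (fun s => ((∑ i, s.weight i : ℕ) : ℝ≥0∞)) fun _ => 0

/-- The properties of a configuration after `t` rounds, where `B` is a set of critical agents. -/
def Invariant (I : AgentProfile n m ε) (B : Finset (Fin n)) (t : ℕ)
    (c : SamplingConfig n m ε) : Prop :=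
  match c.status with
  | Sum.inl s => s.Consistent I ∧ (∀ i, 1 ≤ s.weight i) ∧ 2 ^ t ≤ ∏ i ∈ B, s.weight i
  | Sum.inr o => I.CorrectAnswer o

@[simp]
theorem status_config (x : Memory n m ⊕ Answer m) (q : ℕ) : (config ε x q).status = x := rfl

@[simp]
theorem queries_config (x : Memory n m ⊕ Answer m) (q : ℕ) : (config ε x q).queries = q := rfl

@[simp]
theorem alive_inl (s : Memory n m) (q : ℕ) : alive (config ε (Sum.inl s) q) = 1 := rfl

@[simp]
theorem alive_inr (o : Answer m) (q : ℕ) :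
    alive (config ε (Sum.inr o : Memory n m ⊕ Answer m) q) = 0 := rfl

theorem totalWeight_inl (s : Memory n m) (q : ℕ) :
    totalWeight (config ε (Sum.inl s) q) = (∑ i, s.weight i : ℕ) := rfl

theorem advance_inl (O : Oracle n m) (s : Memory n m) (q : ℕ) :
    (samplingAlgorithm n m ε).advance O (config ε (Sum.inl s) q) =
      (weightedSample s.weight (16 * (m - 1) ^ 2)).map fun D =>
        config ε ((loopBody ε s (agentsOf D)).result O)
          (q + (loopBody ε s (agentsOf D)).numQueries O) :=
  PMF.map_comp _ _ _

theorem advance_inr (O : Oracle n m) (o : Answer m) (q : ℕ) :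
    (samplingAlgorithm n m ε).advance O (config ε (Sum.inr o) q) =
      PMF.pure (config ε (Sum.inr o) q) := rfl

theorem configLaw_zero (O : Oracle n m) : (samplingAlgorithm n m ε).configLaw O 0 =
    PMF.pure (config ε (Sum.inl ⟨fun _ => 1, fun _ => false, fun _ => none⟩) 0) := rfl

variable {I : AgentProfile n m ε} {B : Finset (Fin n)}

theorem prod_weight_le {w w' : Fin n → ℕ} (h : ∀ i, w i ≤ w' i) (hB : ∃ i ∈ B, 2 * w i ≤ w' i) :
    2 * ∏ i ∈ B, w i ≤ ∏ i ∈ B, w' i := by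
  classical
  obtain ⟨i, hi, h2⟩ := hB
  rw [← Finset.mul_prod_erase B w hi, ← Finset.mul_prod_erase B w' hi, ← mul_assoc]
  exact Nat.mul_le_mul h2 (Finset.prod_le_prod' fun j _ => h j)

theorem Invariant.advance (hε : 0 < ε)
    (hB : ∀ A x, I.candidate A = some x → (∀ i ∈ B, I.Accepts i x) → I.UnanimouslyAcceptable x)
    {t : ℕ} {c c' : SamplingConfig n m ε} (hc : Invariant I B t c)
    (hc' : c' ∈ ((samplingAlgorithm n m ε).advance I.oracle c).support) :
    Invariant I B (t + 1) c' := by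
  classical
  obtain ⟨s | o, q, rfl⟩ := exists_eq_config c
  · obtain ⟨hs, hw, hprod⟩ := hc
    rw [advance_inl, PMF.mem_support_map_iff] at hc'
    obtain ⟨D, -, rfl⟩ := hc'
    rcases result_loopBody hε hs (agentsOf D) with
      ⟨hx, h⟩ | ⟨x, hx, ⟨hacc, h⟩ | ⟨hrej, s', h, h1, h2⟩⟩
    · rw [h]
      exact fun ⟨y, hy⟩ => not_unanimouslyAcceptable_of_candidate_eq_none hx y hy
    · rw [h]
      exact hacc
    · rw [h]
      have hle : ∀ i, s.weight i ≤ s'.weight i := fun i => by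
        rw [h2]
        dsimp only
        split_ifs <;> omega
      refine ⟨h1, fun i => (hw i).trans (hle i), ?_⟩
      rw [pow_succ, mul_comm]
      refine (Nat.mul_le_mul_left 2 hprod).trans (prod_weight_le hle ?_)
      -- If no weight in B doubled, all critical agents would have accepted x, and x would be
      -- unanimously acceptable.
      by_contra! hcon
      refine hrej (hB _ x hx fun i hi => ?_)
      by_contra hrej'
      have := hcon i hi
      rw [h2] at this
      simp [hrej'] at this
  · rw [advance_inr, PMF.mem_support_pure_iff] at hc'
    subst hc'
    exact hc

theorem invariant_of_mem_support (hε : 0 < ε)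
    (hB : ∀ A x, I.candidate A = some x → (∀ i ∈ B, I.Accepts i x) → I.UnanimouslyAcceptable x)
    (t : ℕ) : ∀ c ∈ ((samplingAlgorithm n m ε).configLaw I.oracle t).support,
      Invariant I B t c := by
  induction t with
  | zero =>
    intro c hc
    rw [configLaw_zero, PMF.mem_support_pure_iff] at hc
    subst hc
    exact ⟨fun i hi => by simp at hi, fun i => le_rfl, by simp⟩
  | succ t ih =>
    intro c' hc'
    rw [RandomizedAlgorithm.configLaw, PMF.mem_support_bind_iff] at hc'
    obtain ⟨c, hc, hc'⟩ := hc'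
    exact (ih c hc).advance hε hB hc'

/-- The weight added in an unsuccessful round is the number of violating copies. Halting only helps,
since the weight then counts as zero. -/
theorem expect_totalWeight_advance_le (hε : 0 < ε) {t : ℕ} {c : SamplingConfig n m ε}
    (hc : Invariant I B t c) :
    expect ((samplingAlgorithm n m ε).advance I.oracle c) totalWeight ≤
      (1 + ((m + 1 : ℕ) : ℝ≥0∞) / (16 * (m - 1) ^ 2 + 1 : ℕ)) * totalWeight c := by
  classical
  obtain ⟨s | o, q, rfl⟩ := exists_eq_config c
  · obtain ⟨hs, -, -⟩ := hc
    rw [advance_inl, expect_map, add_mul, one_mul]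
    refine le_trans (b := expect (weightedSample s.weight (16 * (m - 1) ^ 2)) fun D =>
      ((∑ i, s.weight i : ℕ) : ℝ≥0∞) + (violators I s.weight D).card) ?_ ?_
    · refine expect_mono fun D _ => ?_
      rcases result_loopBody hε hs (agentsOf D) with
        ⟨hx, h⟩ | ⟨x, hx, ⟨hacc, h⟩ | ⟨hrej, s', h, h1, h2⟩⟩
      · rw [h]
        exact zero_le
      · rw [h]
        exact zero_le
      · rw [h, card_violators I s.weight hx, ← Nat.cast_add, ← Finset.sum_add_distrib]
        refine Nat.cast_le.2 (Finset.sum_le_sum fun i _ => ?_)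
        rw [h2]
        dsimp only
        split_ifs <;> omega
    · rw [expect_add, expect_const]
      exact add_le_add le_rfl (expect_card_violators_le I s.weight _)
  · rw [advance_inr, expect_pure]
    exact zero_le

theorem expect_totalWeight_le (hε : 0 < ε)
    (hB : ∀ A x, I.candidate A = some x → (∀ i ∈ B, I.Accepts i x) → I.UnanimouslyAcceptable x)
    (t : ℕ) :
    expect ((samplingAlgorithm n m ε).configLaw I.oracle t) totalWeight ≤
      (1 + ((m + 1 : ℕ) : ℝ≥0∞) / (16 * (m - 1) ^ 2 + 1 : ℕ)) ^ t * n := by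
  induction t with
  | zero =>
    rw [configLaw_zero, expect_pure]
    simp [totalWeight_inl]
  | succ t ih =>
    rw [RandomizedAlgorithm.configLaw, expect_bind, pow_succ', mul_assoc]
    refine (expect_mono fun c hc =>
      expect_totalWeight_advance_le hε (invariant_of_mem_support hε hB t c hc)).trans ?_
    rw [expect_const_mul]
    exact mul_le_mul_right ih _

theorem expect_alive_le_one (O : Oracle n m) (t : ℕ) :
    expect ((samplingAlgorithm n m ε).configLaw O t) alive ≤ 1 := by
  refine (expect_mono (g := fun _ => 1) fun c _ => ?_).trans_eq (expect_const _ _)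
  obtain ⟨s | o, q, rfl⟩ := exists_eq_config c
  · exact le_rfl
  · exact zero_le

/-! ### Halting probability and query counts in terms of surviving rounds -/

theorem haltProbability_eq (O : Oracle n m) (t : ℕ) :
    (samplingAlgorithm n m ε).haltProbability O t =
      1 - expect ((samplingAlgorithm n m ε).configLaw O t) alive := by
  refine ENNReal.eq_sub_of_add_eq ((expect_alive_le_one O t).trans_lt ENNReal.one_lt_top).ne ?_
  rw [RandomizedAlgorithm.haltProbability, PMF.toOuterMeasure_apply, expect, ← ENNReal.tsum_add,
    ← PMF.tsum_coe ((samplingAlgorithm n m ε).configLaw O t)]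
  refine tsum_congr fun c => ?_
  obtain ⟨s | o, q, rfl⟩ := exists_eq_config c
  · rw [Set.indicator_of_notMem (by rintro ⟨o, ho⟩; simp at ho), alive_inl, zero_add, mul_one]
  · rw [Set.indicator_of_mem (Set.mem_ofPred_eq ▸ ⟨o, rfl⟩), alive_inr, mul_zero, add_zero]

/-- A quantity that grows by at most `K` in each round before halting is at most `K` times the
expected number of rounds, plus its initial value. -/
theorem expect_le_add_sum_alive (O : Oracle n m) (f : SamplingConfig n m ε → ℝ≥0∞) (K : ℝ≥0∞)
    (h : ∀ c, ∀ c' ∈ ((samplingAlgorithm n m ε).advance O c).support,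
      f c' ≤ f c + K * alive c) (t : ℕ) :
    expect ((samplingAlgorithm n m ε).configLaw O t) f ≤
      f (config ε (Sum.inl ⟨fun _ => 1, fun _ => false, fun _ => none⟩) 0) +
        K * ∑ s ∈ Finset.range t, expect ((samplingAlgorithm n m ε).configLaw O s) alive := by
  induction t with
  | zero => simp [configLaw_zero, expect_pure]
  | succ t ih =>
    rw [RandomizedAlgorithm.configLaw, expect_bind, Finset.sum_range_succ, mul_add, ← add_assoc]
    refine (expect_mono fun c _ => ?_ : _ ≤ expect _ fun c => f c + K * alive c).trans ?_
    · exact (expect_mono (h c)).trans_eq (expect_const _ _)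
    · rw [expect_add, expect_const_mul]
      exact add_le_add ih le_rfl

theorem card_agentsOf_le {w : Fin n → ℕ} {r : ℕ} {D : Finset (Copies w)}
    (hD : D ∈ (weightedSample w r).support) : (agentsOf D).card ≤ r := by
  rw [weightedSample, PMF.mem_support_uniformOfFinset_iff, Finset.mem_powersetCard] at hD
  exact Finset.card_image_le.trans (hD.2.trans_le (min_le_left _ _))

theorem expectedQueriesUpTo_le_of_sampleSize {O : Oracle n m} {L : ℕ}
    (hL : ∀ i, (learnHyperplane ε i).numQueries O ≤ L) (t : ℕ) :
    (samplingAlgorithm n m ε).expectedQueriesUpTo O t ≤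
      (n + L * (16 * (m - 1) ^ 2) : ℕ) *
        ∑ s ∈ Finset.range t, expect ((samplingAlgorithm n m ε).configLaw O s) alive := by
  have h := expect_le_add_sum_alive (ε := ε) O (fun c => (c.queries : ℝ≥0∞))
    (n + L * (16 * (m - 1) ^ 2) : ℕ) (fun c c' hc' => ?_) t
  · simpa [RandomizedAlgorithm.expectedQueriesUpTo, expect, config] using h
  · obtain ⟨s | o, q, rfl⟩ := exists_eq_config c
    · rw [advance_inl, PMF.mem_support_map_iff] at hc'
      obtain ⟨D, hD, rfl⟩ := hc'
      have h1 := (numQueries_loopBody_le hL s (agentsOf D)).1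
      have h2 := Nat.mul_le_mul_left L (card_agentsOf_le hD)
      simp only [alive_inl, queries_config, mul_one]
      exact_mod_cast (by omega : q + (loopBody ε s (agentsOf D)).numQueries O ≤
        q + (n + L * (16 * (m - 1) ^ 2)))
    · rw [advance_inr, PMF.mem_support_pure_iff] at hc'
      subst hc'
      exact le_self_add

/-- Queries made plus L times the number of unlearned agents is a potential that starts at L n and
grows by at most n per round, the cost of the acceptance test. -/
theorem expectedQueriesUpTo_le_of_numAgents {O : Oracle n m} {L : ℕ}
    (hL : ∀ i, (learnHyperplane ε i).numQueries O ≤ L) (t : ℕ) :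
    (samplingAlgorithm n m ε).expectedQueriesUpTo O t ≤ (L * n : ℕ) +
      n * ∑ s ∈ Finset.range t, expect ((samplingAlgorithm n m ε).configLaw O s) alive := by
  have h := expect_le_add_sum_alive (ε := ε) O
    (fun c => ((c.queries + remainingCost L c.status : ℕ) : ℝ≥0∞)) n (fun c c' hc' => ?_) t
  · refine (expect_mono fun c _ => ?_).trans (h.trans_eq ?_)
    · exact Nat.cast_le.2 (Nat.le_add_right _ _)
    · simp [remainingCost, Memory.numUnknown, config]
  · obtain ⟨s | o, q, rfl⟩ := exists_eq_config c
    · rw [advance_inl, PMF.mem_support_map_iff] at hc'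
      obtain ⟨D, hD, rfl⟩ := hc'
      have h1 := (numQueries_loopBody_le hL s (agentsOf D)).2
      simp only [alive_inl, queries_config, status_config, mul_one]
      have h3 : remainingCost L (Sum.inl s : Memory n m ⊕ Answer m) = L * s.numUnknown := rfl
      exact_mod_cast (by omega : q + (loopBody ε s (agentsOf D)).numQueries O +
        remainingCost L ((loopBody ε s (agentsOf D)).result O) ≤
          q + remainingCost L (Sum.inl s : Memory n m ⊕ Answer m) + n)
    · rw [advance_inr, PMF.mem_support_pure_iff] at hc'
      subst hc'
      exact le_self_add

end

/-! ### Quantitative bounds -/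

section

variable {n m : ℕ} {ε : ℝ} {I : AgentProfile n m ε} {B : Finset (Fin n)}

/-- Each factor is at most W, so 2^t ≤ W^(m+1). The constant is admissible because m + 1 ≤ 3m/2 and
(2/3) log 2 > 23/50. -/
theorem exp_le_sum_weight (hm : 2 ≤ m) (hBcard : B.card ≤ m + 1) {t : ℕ} {w : Fin n → ℕ}
    (hn : 0 < n) (hw : ∀ i, 1 ≤ w i) (hprod : 2 ^ t ≤ ∏ i ∈ B, w i) :
    Real.exp (23 / 50 * t / m) ≤ (∑ i, w i : ℕ) := by
  have hW : 1 ≤ ∑ i, w i := (hw ⟨0, hn⟩).trans (Finset.single_le_sum_of_canonicallyOrdered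
    (f := w) (Finset.mem_univ _))
  have h1 : 2 ^ t ≤ (∑ i, w i) ^ (m + 1) := hprod.trans <|
    (Finset.prod_le_pow_card _ _ _ fun i _ => Finset.single_le_sum_of_canonicallyOrdered
      (f := w) (Finset.mem_univ i)).trans (Nat.pow_le_pow_right hW hBcard)
  have hW' : (0 : ℝ) < (∑ i, w i : ℕ) := by exact_mod_cast hW
  have h2 : (2 : ℝ) ^ t ≤ ((∑ i, w i : ℕ) : ℝ) ^ (m + 1) := by exact_mod_cast h1
  have h3 := Real.log_le_log (by positivity) h2
  rw [Real.log_pow, Real.log_pow] at h3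
  rw [← Real.le_log_iff_exp_le hW', div_le_iff₀ (by positivity)]
  have hlogW : 0 ≤ Real.log (∑ i, w i : ℕ) := Real.log_nonneg (by exact_mod_cast hW)
  have hm' : (2 : ℝ) ≤ m := by exact_mod_cast hm
  have hlog2 := Real.log_two_gt_d9
  have ht : (0 : ℝ) ≤ t := Nat.cast_nonneg t
  push_cast at h3 hlogW ⊢
  nlinarith

/-- After 1 + y ≤ exp y this is 8m(m + 1) ≤ 3(16(m - 1)² + 1), which is nearly tight at m = 2 (48
against 51). -/
theorem growth_le_exp (hm : 2 ≤ m) :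
    1 + ((m + 1 : ℕ) : ℝ≥0∞) / (16 * (m - 1) ^ 2 + 1 : ℕ) ≤
      ENNReal.ofReal (Real.exp (3 / 8 / m)) := by
  obtain ⟨d, rfl⟩ : ∃ d, m = d + 2 := ⟨m - 2, by omega⟩
  have h : 1 + ((d + 2 + 1 : ℕ) : ℝ≥0∞) / (16 * (d + 2 - 1) ^ 2 + 1 : ℕ) =
      ENNReal.ofReal (1 + ((d + 2 + 1 : ℕ) : ℝ) / (16 * (d + 2 - 1) ^ 2 + 1 : ℕ)) := by
    rw [ENNReal.ofReal_add zero_le_one (by positivity), ENNReal.ofReal_one,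
      ENNReal.ofReal_div_of_pos (by positivity), ENNReal.ofReal_natCast, ENNReal.ofReal_natCast]
  rw [h]
  refine ENNReal.ofReal_le_ofReal (le_trans ?_ (Real.add_one_le_exp _))
  rw [add_comm, add_le_add_iff_right, show d + 2 - 1 = d + 1 from rfl,
    div_le_div_iff₀ (by positivity) (by positivity)]
  push_cast
  nlinarith [(Nat.cast_nonneg d : (0 : ℝ) ≤ d)]

/-- Markov's inequality: a run alive after t rounds has weight at least exp(23t/(50m)), while the
expected weight is at most n exp(3t/(8m)). -/
theorem expect_alive_le_exp (hε : 0 < ε) (hn : 0 < n) (hm : 2 ≤ m) (I : AgentProfile n m ε)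
    (t : ℕ) :
    expect ((samplingAlgorithm n m ε).configLaw I.oracle t) alive ≤
      ENNReal.ofReal (n * Real.exp (-(t / (12 * m)))) := by
  obtain ⟨B, hBcard, hB⟩ := exists_critical_agents I
  have hm' : (2 : ℝ) ≤ m := by exact_mod_cast hm
  have h1 : ENNReal.ofReal (Real.exp (23 / 50 * t / m)) *
      expect ((samplingAlgorithm n m ε).configLaw I.oracle t) alive ≤
        ENNReal.ofReal (n * Real.exp (3 / 8 / m) ^ t) := by
    rw [← expect_const_mul]
    refine le_trans ((expect_mono (g := totalWeight) fun c hc => ?_).trans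
      (expect_totalWeight_le hε hB t)) ?_
    · have hinv := invariant_of_mem_support hε hB t c hc
      obtain ⟨s | o, q, rfl⟩ := exists_eq_config c
      · obtain ⟨-, hw, hprod⟩ := hinv
        rw [alive_inl, mul_one, totalWeight_inl, ← ENNReal.ofReal_natCast]
        exact ENNReal.ofReal_le_ofReal (exp_le_sum_weight hm hBcard hn hw hprod)
      · rw [alive_inr, mul_zero]
        exact zero_le
    · rw [mul_comm, ENNReal.ofReal_mul (by positivity), ENNReal.ofReal_natCast,
        ENNReal.ofReal_pow (by positivity)]
      exact mul_le_mul_right (pow_le_pow_left' (growth_le_exp hm) t) _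
  have h2 : n * Real.exp (3 / 8 / m) ^ t ≤
      Real.exp (23 / 50 * t / m) * (n * Real.exp (-(t / (12 * m)))) := by
    rw [← Real.exp_nat_mul, mul_left_comm, ← Real.exp_add]
    refine mul_le_mul_of_nonneg_left (Real.exp_le_exp.2 ?_) (Nat.cast_nonneg n)
    -- The slack is 23/50 - 3/8 - 1/12 = 1/600.
    have h3 : 23 / 50 * (t : ℝ) / m + -(t / (12 * m)) - t * (3 / 8 / m) =
        (t : ℝ) / m * (1 / 600) := by
      field_simp
      ring
    have h4 : 0 ≤ (t : ℝ) / m * (1 / 600) := by positivity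
    linarith
  have h5 := h1.trans (ENNReal.ofReal_le_ofReal h2)
  rw [ENNReal.ofReal_mul (Real.exp_pos _).le] at h5
  exact (ENNReal.mul_le_mul_iff_right (by simp [Real.exp_pos]) ENNReal.ofReal_ne_top).1 h5

theorem sum_range_exp_le {x : ℝ} (hx : 0 < x) (T : ℕ) :
    ∑ j ∈ Finset.range T, Real.exp (-(j * x)) ≤ 1 + 1 / x := by
  have h1 : ∀ j : ℕ, Real.exp (-(j * x)) = Real.exp (-x) ^ j := fun j => by
    rw [← Real.exp_nat_mul, mul_neg]
  simp only [h1]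
  have h2 := geom_sum_mul_neg (Real.exp (-x)) T
  have h3 : Real.exp (-x) * (1 + x) ≤ 1 := by
    rw [Real.exp_neg, inv_mul_le_one₀ (Real.exp_pos x), add_comm]
    exact Real.add_one_le_exp x
  have h4 : 0 ≤ Real.exp (-x) ^ T := by positivity
  have h5 : x / (1 + x) ≤ 1 - Real.exp (-x) := by
    rw [div_le_iff₀ (by linarith)]
    linarith
  have h6 : 0 ≤ ∑ j ∈ Finset.range T, Real.exp (-x) ^ j :=
    Finset.sum_nonneg fun j _ => by positivity
  have h7 := (mul_le_mul_of_nonneg_left h5 h6).trans (by linarith : _ ≤ (1 : ℝ))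
  rw [← mul_div_assoc, div_le_one (by linarith)] at h7
  have h8 : (1 + 1 / x) = (1 + x) / x := by field_simp; ring
  rw [h8, le_div_iff₀ hx]
  exact h7

/-- The bound 1 is used for the first K terms; from K on, y exp(-Kx) ≤ 1, and a geometric series
remains. -/
theorem sum_le_of_le_exp {a : ℕ → ℝ} {y x : ℝ} (hx : 0 < x) (hy : 1 ≤ y) (h0 : ∀ t, 0 ≤ a t)
    (h1 : ∀ t, a t ≤ 1) (h2 : ∀ t : ℕ, a t ≤ y * Real.exp (-(t * x))) (T : ℕ) :
    ∑ t ∈ Finset.range T, a t ≤ Real.log y / x + 2 + 1 / x := by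
  set K := ⌈Real.log y / x⌉₊ with hK
  have hlog : 0 ≤ Real.log y := Real.log_nonneg hy
  have hK1 : (K : ℝ) ≤ Real.log y / x + 1 := (Nat.ceil_lt_add_one (by positivity)).le
  have hK2 : Real.log y ≤ K * x := (div_le_iff₀ hx).1 (Nat.le_ceil _)
  calc ∑ t ∈ Finset.range T, a t ≤ ∑ t ∈ Finset.range (K + T), a t :=
        Finset.sum_le_sum_of_subset_of_nonneg (Finset.range_subset_range.2 (by omega))
          fun t _ _ => h0 t
    _ = ∑ t ∈ Finset.range K, a t + ∑ j ∈ Finset.range T, a (K + j) := Finset.sum_range_add _ _ _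
    _ ≤ K + (1 + 1 / x) := by
        refine add_le_add ?_ ((Finset.sum_le_sum fun j _ => ?_).trans (sum_range_exp_le hx T))
        · simpa using Finset.sum_le_card_nsmul (Finset.range K) a 1 fun t _ => h1 t
        · refine (h2 _).trans ?_
          nth_rewrite 1 [← Real.exp_log (by linarith : 0 < y)]
          rw [← Real.exp_add, Real.exp_le_exp]
          push_cast
          linarith
    _ ≤ _ := by linarith

theorem sum_expect_alive_le (hε : 0 < ε) (hn : 2 ≤ n) (hm : 2 ≤ m) (I : AgentProfile n m ε)
    (T : ℕ) :
    ∑ t ∈ Finset.range T, expect ((samplingAlgorithm n m ε).configLaw I.oracle t) alive ≤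
      ENNReal.ofReal (32 * (m * Real.log n)) := by
  have hm' : (2 : ℝ) ≤ m := by exact_mod_cast hm
  have hn' : (2 : ℝ) ≤ n := by exact_mod_cast hn
  have hfin : ∀ t, expect ((samplingAlgorithm n m ε).configLaw I.oracle t) alive ≠ ∞ := fun t =>
    ((expect_alive_le_one I.oracle t).trans_lt ENNReal.one_lt_top).ne
  have h := sum_le_of_le_exp
    (a := fun t => (expect ((samplingAlgorithm n m ε).configLaw I.oracle t) alive).toReal)
    (y := n) (x := 1 / (12 * m)) (by positivity) (by linarith) (fun t => ENNReal.toReal_nonneg)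
    (fun t => ENNReal.toReal_le_of_le_ofReal zero_le_one
      (by simpa using expect_alive_le_one I.oracle t))
    (fun t => ENNReal.toReal_le_of_le_ofReal (by positivity) (by
      simpa [div_eq_mul_inv] using expect_alive_le_exp hε (by omega) hm I t)) T
  rw [← ENNReal.toReal_sum fun t _ => hfin t] at h
  rw [← ENNReal.ofReal_toReal (ENNReal.sum_ne_top.2 fun t _ => hfin t)]
  refine ENNReal.ofReal_le_ofReal (h.trans ?_)
  have hlog : 69 / 100 ≤ Real.log n :=
    (by linarith [Real.log_two_gt_d9] : (69 : ℝ) / 100 ≤ Real.log 2).trans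
      (Real.log_le_log (by norm_num) hn')
  rw [one_div_one_div, div_div_eq_mul_div, div_one]
  -- What remains is 12 m log n + 2 + 12 m ≤ 32 m log n, which follows from log n ≥ 0.69 and m ≥ 2.
  nlinarith

theorem haltsAlmostSurely (hε : 0 < ε) (hn : 2 ≤ n) (hm : 2 ≤ m) (I : AgentProfile n m ε) :
    (samplingAlgorithm n m ε).HaltsAlmostSurely I.oracle := by
  have hm' : (2 : ℝ) ≤ m := by exact_mod_cast hm
  have h1 : Filter.Tendsto (fun t : ℕ => (n : ℝ) * Real.exp (-(t / (12 * m)))) Filter.atTop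
      (nhds (n * 0)) :=
    (Real.tendsto_exp_neg_atTop_nhds_zero.comp
      (tendsto_natCast_atTop_atTop.atTop_div_const (by positivity))).const_mul _
  have h2 := ENNReal.tendsto_ofReal h1
  rw [mul_zero, ENNReal.ofReal_zero] at h2
  have h3 : Filter.Tendsto
      (fun t => expect ((samplingAlgorithm n m ε).configLaw I.oracle t) alive)
      Filter.atTop (nhds 0) :=
    tendsto_of_tendsto_of_tendsto_of_le_of_le tendsto_const_nhds h2 (fun _ => zero_le)
      (expect_alive_le_exp hε (by omega) hm I)
  have h4 := ENNReal.Tendsto.sub (tendsto_const_nhds (x := (1 : ℝ≥0∞))) h3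
    (Or.inl ENNReal.one_ne_top)
  rw [tsub_zero] at h4
  exact h4.congr fun t => (haltProbability_eq I.oracle t).symm

theorem correctAnswer_of_canReturn (hε : 0 < ε) (I : AgentProfile n m ε) {o : Answer m}
    (ho : (samplingAlgorithm n m ε).CanReturn I.oracle o) : I.CorrectAnswer o := by
  obtain ⟨B, -, hB⟩ := exists_critical_agents I
  obtain ⟨t, c, hc, hco⟩ := ho
  have h := invariant_of_mem_support hε hB t c hc
  rw [Invariant, hco] at h
  exact h

/-- With K = 1/ε, the number of bisection steps is the least exponent whose power of two exceeds 2K²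
= 2/ε². Since K ≥ 2, all additive constants are absorbed into log K, which gives the factor 14. -/
theorem exists_learning_cost (m : ℕ) {K : ℕ} (hε : 0 < ε) (hε' : ε ≤ 1 / 2)
    (hK : 1 / ε = (K : ℝ)) :
    ∃ L : ℕ, (L : ℝ) ≤ 14 * (m * Real.log (1 / ε)) ∧
      ∀ (n : ℕ) (I : AgentProfile n m ε) (i : Fin n),
        (learnHyperplane ε i).numQueries I.oracle ≤ L := by
  have hK2 : (2 : ℝ) ≤ K := by
    rw [← hK, le_div_iff₀ hε]
    linarith
  have hN : 2 * K ^ 2 < 2 ^ (Nat.log 2 (2 * K ^ 2) + 1) :=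
    Nat.lt_pow_succ_log_self one_lt_two _
  have hN' : 2 ^ Nat.log 2 (2 * K ^ 2) ≤ 2 * K ^ 2 := Nat.pow_log_le_self 2 (by
    have : 2 ≤ K := by exact_mod_cast hK2
    positivity)
  generalize Nat.log 2 (2 * K ^ 2) = N at hN hN'
  refine ⟨m * (1 + 2 * (N + 1)), ?_, fun n I i => numQueries_learnHyperplane_le hε ?_⟩
  · have h1 : (2 : ℝ) ^ N ≤ 2 * K ^ 2 := by exact_mod_cast hN'
    have h2 := Real.log_le_log (by positivity) h1
    rw [Real.log_pow, Real.log_mul (by norm_num) (by positivity), Real.log_pow] at h2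
    have hlog2 := Real.log_two_gt_d9
    have hlogK : Real.log 2 ≤ Real.log K := Real.log_le_log (by norm_num) hK2
    rw [hK]
    push_cast at h2 ⊢
    rw [mul_left_comm]
    refine mul_le_mul_of_nonneg_left ?_ (Nat.cast_nonneg m)
    have hN0 : (0 : ℝ) ≤ N := Nat.cast_nonneg N
    nlinarith
  · have h1 : (2 * (K : ℝ) ^ 2) < 2 ^ (N + 1) := by exact_mod_cast hN
    have h2 : ε ^ 2 * (K : ℝ) ^ 2 = 1 := by
      rw [← hK]
      field_simp
    have h3 := mul_lt_mul_of_pos_right h1 (by positivity : 0 < ε ^ 2 / 2)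
    calc (1 : ℝ) = 2 * (K : ℝ) ^ 2 * (ε ^ 2 / 2) := by rw [← h2]; ring
      _ < _ := h3

theorem expectedQueries_le (hε : 0 < ε) (hn : 2 ≤ n) (hm : 2 ≤ m) (I : AgentProfile n m ε) {L : ℕ}
    (hL : ∀ i, (learnHyperplane ε i).numQueries I.oracle ≤ L) :
    (samplingAlgorithm n m ε).expectedQueries I.oracle ≤ ENNReal.ofReal
      (512 * (n * m * Real.log n + min (n : ℝ) (m ^ 3 * Real.log n) * L)) := by
  have hm' : (2 : ℝ) ≤ m := by exact_mod_cast hm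
  have hn' : (2 : ℝ) ≤ n := by exact_mod_cast hn
  have hlog : 0 ≤ Real.log n := Real.log_nonneg (by linarith)
  have hL0 : (0 : ℝ) ≤ L := Nat.cast_nonneg L
  have hnml : 0 ≤ n * m * Real.log n := by positivity
  refine iSup_le fun t => ?_
  have hsum := sum_expect_alive_le hε hn hm I t
  -- Whichever term attains the minimum decides how learning is charged. The constant is 512 = 16 ·
  -- 32, from the sample size and the number of rounds.
  rcases min_cases (n : ℝ) (m ^ 3 * Real.log n) with ⟨h, -⟩ | ⟨h, -⟩
  · refine (expectedQueriesUpTo_le_of_numAgents hL t).trans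
      ((add_le_add le_rfl (mul_le_mul_right hsum _)).trans ?_)
    rw [← ENNReal.ofReal_natCast (L * n), ← ENNReal.ofReal_natCast n,
      ← ENNReal.ofReal_mul (by positivity), ← ENNReal.ofReal_add (by positivity) (by positivity), h]
    refine ENNReal.ofReal_le_ofReal ?_
    push_cast
    have : 0 ≤ (n : ℝ) * L := by positivity
    linarith
  · refine (expectedQueriesUpTo_le_of_sampleSize hL t).trans
      ((mul_le_mul_right hsum _).trans ?_)
    rw [← ENNReal.ofReal_natCast, ← ENNReal.ofReal_mul (by positivity), h]
    refine ENNReal.ofReal_le_ofReal ?_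
    have hsub : ((16 * (m - 1) ^ 2 : ℕ) : ℝ) ≤ 16 * m ^ 2 := by
      exact_mod_cast Nat.mul_le_mul_left 16 (Nat.pow_le_pow_left (Nat.sub_le m 1) 2)
    rw [Nat.cast_add, Nat.cast_mul, add_mul]
    have h2 : (L : ℝ) * ((16 * (m - 1) ^ 2 : ℕ) : ℝ) * (32 * (m * Real.log n)) ≤
        L * (16 * m ^ 2) * (32 * (m * Real.log n)) := by gcongr
    have h3 : (L : ℝ) * (16 * m ^ 2) * (32 * (m * Real.log n)) =
        512 * (m ^ 3 * Real.log n * L) := by ring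
    linarith

end

end LotteryElicitation

end

theorem mainTheorem1 :
    ∃ C : ℝ, 0 < C ∧
      ∀ (n m : ℕ) (ε : ℝ), 2 ≤ n → 2 ≤ m →
        0 < ε → ε ≤ 1 / 2 → (∃ K : ℕ, 1 / ε = (K : ℝ)) →
        ∀ I : LotteryElicitation.AgentProfile n m ε,
          (∀ o : LotteryElicitation.Answer m,
            (LotteryElicitation.samplingAlgorithm n m ε).CanReturn I.oracle o →
              I.CorrectAnswer o) ∧
          (LotteryElicitation.samplingAlgorithm n m ε).HaltsAlmostSurely I.oracle ∧
          (LotteryElicitation.samplingAlgorithm n m ε).expectedQueries I.oracle ≤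
            ENNReal.ofReal (C *
              ((n : ℝ) * m * Real.log n +
                min (n : ℝ) ((m : ℝ) ^ 3 * Real.log n) * (m * Real.log (1 / ε)))) := by
  -- 7168 = 512 · 14, from `expectedQueries_le` and `exists_learning_cost`.
  refine ⟨7168, by norm_num, fun n m ε hn hm hε hε' ⟨K, hK⟩ I =>
    ⟨fun o => LotteryElicitation.correctAnswer_of_canReturn hε I,
      LotteryElicitation.haltsAlmostSurely hε hn hm I, ?_⟩⟩
  obtain ⟨L, hL, hcost⟩ := LotteryElicitation.exists_learning_cost m hε hε' hK
  refine (LotteryElicitation.expectedQueries_le hε hn hm I (hcost n I)).trans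
    (ENNReal.ofReal_le_ofReal ?_)
  have hlog : 0 ≤ Real.log n := Real.log_nonneg (by exact_mod_cast (by omega : 1 ≤ n))
  have hmin : 0 ≤ min (n : ℝ) ((m : ℝ) ^ 3 * Real.log n) := le_min (by positivity) (by positivity)
  have h1 := mul_le_mul_of_nonneg_left hL hmin
  have h2 : 0 ≤ (n : ℝ) * m * Real.log n := by positivity
  linarith
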